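/- Let $m\ge 1$ and $a>0$. Let $\mathbf C^{(m)}$ be the complex Clifford algebra generated by $\mathbf e_1,\dots,\mathbf e_m$ with $\mathbf e_j\mathbf e_k+\mathbf e_k\mathbf e_j=-2\delta_{jk}$, with basis $\mathbf e_T=\mathbf e_{j_1}\cdots\mathbf e_{j_l}$ ($T=\{j_1<\dots<j_l\}$), norm $|\sum_T x_T\mathbf e_T|=(\sum_T|x_T|^2)^{1/2}$, and conjugation $\overline{\sum_T x_T\mathbf e_T}=\sum_T\overline{x_T}\,\overline{\mathbf e_T}$, $\overline{\mathbf e_T}=(-1)^l\mathbf e_{j_l}\cdots\mathbf e_{j_1}$. Write points of $\mathbf R^{m+1}$ as $x=x_0+\underline x$ with $x_0\in\mathbf R$ and $\underline x=\sum_j x_j\mathbf e_j\in\mathbf R^m$, so that $\bar x=x_0-\underline x$. Put $\Omega_+=\{x: x_0>-a\}$ and $\Omega_-=\{x: x_0<a\}$. A $C^1$ function $f:\Omega_\pm\to\mathbf C^{(m)}$ is left-monogenic if $\partial_0f+\sum_{k=1}^m\mathbf e_k\partial_kf=0$. Let $A^2(\Omega_\pm)$ be the Bergman space of left-monogenic $f$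 on $\Omega_\pm$ with $\int_{\Omega_\pm}|f|^2\,dx<\infty$ and inner product $\langle f,h\rangle=\int_{\Omega_\pm}\overline{h}\,f\,dx$. Let $H^2(\Omega_\pm)$ be the Hardy space of left-monogenic $f$ on $\Omega_\pm$ with $\sup_{x_0}\int_{\mathbf R^m}|f(x_0+\underline x)|^2d\underline x<\infty$ (supremum over $x_0>-a$, respectively $x_0<a$), with inner product $\langle f,h\rangle=\lim_{x_0\to\mp a}\int_{\mathbf R^m}\overline{h(x_0+\underline x)}f(x_0+\underline x)\,d\underline x$, the limit being taken inside $\Omega_\pm$. The reproducing kernels $B_\pm(w,\bar x)$ of $A^2(\Omega_\pm)$ and $S_\pm(w,\bar x)$ of $H^2(\Omega_\pm)$, that is, the functions belonging to the space in $w$ and satisfying $f(x)=\langle f,K(\cdot,\bar x)\rangle$ for all $f$ in the space and all $x\in\Omega_\pm$, are called the Bergman and the Szegő kernel. Put $\chi_\pm(\underline\xi)=\frac12\bigl(1\pm i\frac{\underline\xi}{|\underline\xi|}\bigr)$ and $e^\pm(x,\underline\xi)=e^{i\langle\underline x,\underline\xi\rangle}e^{\mp x_0|\underline\xi|}\chi_\pm(\underline\xi)$,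 and let $\mathcal F$ be the extension to $L^2(\mathbf R^m,\mathbf C^{(m)})$ of $\mathcal F h(\underline\xi)=\int_{\mathbf R^m}e^{-i\langle\underline x,\underline\xi\rangle}h(\underline x)\,d\underline x$. **Theorem.** For each choice of the sign $\pm$: 1. A function $f$ on $\Omega_\pm$ belongs to $A^2(\Omega_\pm)$ if and only if its restriction $f|_{\mathbf R^m}$ to $x_0=0$ is in $L^2(\mathbf R^m,\mathbf C^{(m)})$ and, with $g=\mathcal F(f|_{\mathbf R^m})\in L^2(\mathbf R^m,\mathbf C^{(m)})$, $$\int_{\mathbf R^m}e^{2a|\underline\xi|}\frac{|\chi_\pm(\underline\xi)g(\underline\xi)|^2}{2|\underline\xi|}\,d\underline\xi<\infty\quad\text{and}\quad f(x)=\frac1{(2\pi)^m}\int_{\mathbf R^m}e^\pm(x,\underline\xi)g(\underline\xi)\,d\underline\xi\quad(x\in\Omega_\pm),$$ the last integral being absolutely convergent. 2. The Szegő kernel $S_\pm$ and the Bergman kernel $B_\pm$ of $\Omega_\pm$ exist and are unique, and for all $w,x\in\Omega_\pm$ $$S_\pm(w,\bar x)=\frac1{(2\pi)^m}\int_{\mathbf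 R^m}e^{-2a|\underline\xi|}e^\pm(w+\bar x,\underline\xi)\,d\underline\xi,$$ $$B_\pm(w,\bar x)=\frac1{(2\pi)^m}\int_{\mathbf R^m}2|\underline\xi|e^{-2a|\underline\xi|}e^\pm(w+\bar x,\underline\xi)\,d\underline\xi=\mp2\frac{\partial}{\partial x_0}S_\pm(w,\bar x).$$ -/

import Mathlib

open scoped symmDiff

namespace CliffordHalfSpace

noncomputable section

/-! ### The complex Clifford algebra -/

/-- The underlying space of the complex Clifford algebra `ℂ^(m)`: an element is the family of its
coordinates `x_T` with respect to the basis `e_T`, `T ⊆ {1, …, m}`, and its norm is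
`(∑_T |x_T|²)^(1/2)`. -/
abbrev Cl (m : ℕ) : Type := EuclideanSpace ℂ (Finset (Fin m))

/-- The sign in `e_S e_T = sgn S T • e_{S ∆ T}`: bringing the product into increasing order costs
one factor `-1` for each inversion and one for each square `e_j² = -1`. -/
def sgn {m : ℕ} (S T : Finset (Fin m)) : ℂ := ∏ i ∈ S, ∏ j ∈ T, if j ≤ i then -1 else 1

lemma prod_symmDiff {ι : Type*} [DecidableEq ι] (f : ι → ℂ) (hf : ∀ i, f i * f i = 1)
    (S T : Finset ι) : ∏ i ∈ S ∆ T, f i = (∏ i ∈ S, f i) * ∏ i ∈ T, f i := by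
  have h1 : ∏ i ∈ S ∆ T, f i = (∏ i ∈ S \ T, f i) * ∏ i ∈ T \ S, f i := by
    have hd : Disjoint (S \ T) (T \ S) := disjoint_sdiff_sdiff
    rw [← Finset.prod_union hd]
    rfl
  have h2 := Finset.prod_inter_mul_prod_sdiff S T f
  have h3 := Finset.prod_inter_mul_prod_sdiff T S f
  have h4 : (∏ i ∈ S ∩ T, f i) * ∏ i ∈ S ∩ T, f i = 1 := by
    rw [← Finset.prod_mul_distrib]
    exact Finset.prod_eq_one fun i _ => hf i
  rw [Finset.inter_comm T S] at h3
  rw [h1, ← h2, ← h3]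
  linear_combination (-(∏ i ∈ S \ T, f i) * ∏ i ∈ T \ S, f i) * h4

lemma sgn_mul_self {m : ℕ} (S T : Finset (Fin m)) : sgn S T * sgn S T = 1 := by
  unfold sgn
  rw [← Finset.prod_mul_distrib]
  refine Finset.prod_eq_one fun i _ => ?_
  rw [← Finset.prod_mul_distrib]
  refine Finset.prod_eq_one fun j _ => ?_
  split_ifs <;> norm_num

lemma sgn_symmDiff_left {m : ℕ} (S T U : Finset (Fin m)) :
    sgn (S ∆ T) U = sgn S U * sgn T U := by
  unfold sgn
  refine prod_symmDiff _ (fun i => ?_) S T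
  rw [← Finset.prod_mul_distrib]
  refine Finset.prod_eq_one fun j _ => ?_
  split_ifs <;> norm_num

lemma sgn_symmDiff_right {m : ℕ} (S T U : Finset (Fin m)) :
    sgn S (T ∆ U) = sgn S T * sgn S U := by
  unfold sgn
  rw [← Finset.prod_mul_distrib]
  refine Finset.prod_congr rfl fun i _ => prod_symmDiff _ (fun j => ?_) T U
  split_ifs <;> norm_num

instance instMulCl (m : ℕ) : Mul (Cl m) :=
  ⟨fun x y => WithLp.toLp 2 fun U => ∑ S, sgn S (S ∆ U) * (x S * y (S ∆ U))⟩

instance instOneCl (m : ℕ) : One (Cl m) := ⟨EuclideanSpace.single ∅ 1⟩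

lemma mul_coord {m : ℕ} (x y : Cl m) (U : Finset (Fin m)) :
    (x * y) U = ∑ S, sgn S (S ∆ U) * (x S * y (S ∆ U)) := rfl

lemma one_coord {m : ℕ} (U : Finset (Fin m)) : (1 : Cl m) U = if U = ∅ then 1 else 0 := by
  change (EuclideanSpace.single ∅ (1 : ℂ) : Cl m) U = _
  rw [PiLp.single_apply]

lemma cl_mul_assoc {m : ℕ} (x y z : Cl m) : x * y * z = x * (y * z) := by
  ext U
  simp only [mul_coord, Finset.sum_mul, Finset.mul_sum]
  rw [Finset.sum_comm]
  refine Finset.sum_congr rfl fun S _ => ?_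
  refine Fintype.sum_equiv ⟨fun T => S ∆ T, fun T => S ∆ T, symmDiff_symmDiff_cancel_left S,
    symmDiff_symmDiff_cancel_left S⟩ _ _ fun R => ?_
  simp only [Equiv.coe_fn_mk]
  have h : S ∆ R ∆ (S ∆ U) = R ∆ U := by
    rw [symmDiff_symmDiff_symmDiff_comm, symmDiff_self, bot_symmDiff]
  rw [h]
  have hs : sgn R (R ∆ U) * sgn S (S ∆ R) = sgn S (S ∆ U) * sgn (S ∆ R) (R ∆ U) := by
    simp only [sgn_symmDiff_left, sgn_symmDiff_right]
    linear_combination (-(sgn S S * sgn S R * sgn R R * sgn R U)) * sgn_mul_self S U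
  linear_combination (x S * y (S ∆ R) * z (R ∆ U)) * hs

instance instRingCl (m : ℕ) : Ring (Cl m) :=
  { (inferInstance : AddCommGroup (Cl m)) with
    mul := (· * ·)
    one := 1
    mul_assoc := cl_mul_assoc
    one_mul := fun x => by
      ext U
      rw [mul_coord, Finset.sum_eq_single ∅]
      · have h : (∅ : Finset (Fin m)) ∆ U = U := bot_symmDiff U
        simp [one_coord, sgn, h]
      · intro S _ hS
        simp [one_coord, hS]
      · simp
    mul_one := fun x => by
      ext U
      rw [mul_coord, Finset.sum_eq_single U]
      · simp [one_coord, sgn]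
      · intro S _ hS
        simp [one_coord, hS]
      · simp
    left_distrib := fun x y z => by
      ext U
      simp only [mul_coord, PiLp.add_apply, mul_add, Finset.sum_add_distrib]
    right_distrib := fun x y z => by
      ext U
      simp only [mul_coord, PiLp.add_apply, add_mul, mul_add, Finset.sum_add_distrib]
    zero_mul := fun x => by
      ext U
      simp [mul_coord]
    mul_zero := fun x => by
      ext U
      simp [mul_coord] }

instance instAlgebraCl (m : ℕ) : Algebra ℂ (Cl m) :=
  Algebra.ofModule
    (fun c x y => by
      ext U
      simp only [mul_coord, PiLp.smul_apply, smul_eq_mul, Finset.mul_sum]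
      exact Finset.sum_congr rfl fun S _ => by ring)
    (fun c x y => by
      ext U
      simp only [mul_coord, PiLp.smul_apply, smul_eq_mul, Finset.mul_sum]
      exact Finset.sum_congr rfl fun S _ => by ring)

/-- The basis element `e_T = e_{j_1} ⋯ e_{j_l}`, `T = {j_1 < ⋯ < j_l}`. -/
def basisElt {m : ℕ} (T : Finset (Fin m)) : Cl m := EuclideanSpace.single T 1

/-- The generator `e_j`. -/
def gen {m : ℕ} (j : Fin m) : Cl m := basisElt {j}

lemma basisElt_mul {m : ℕ} (S T : Finset (Fin m)) :
    basisElt S * basisElt T = sgn S T • basisElt (S ∆ T) := by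
  ext U
  rw [mul_coord, Finset.sum_eq_single S]
  · simp only [basisElt, PiLp.single_apply, PiLp.smul_apply, smul_eq_mul, if_true]
    by_cases h : U = S ∆ T
    · subst h
      simp
    · have h' : S ∆ U ≠ T := fun h' => h (by rw [← h', symmDiff_symmDiff_cancel_left])
      simp [h, h']
  · intro R _ hR
    simp [basisElt, PiLp.single_apply, hR]
  · simp

/-- `e_j e_k + e_k e_j = -2 δ_{jk}`. -/
lemma gen_mul_add {m : ℕ} (j k : Fin m) :
    gen j * gen k + gen k * gen j = if j = k then -2 else 0 := by
  have h1 : (basisElt ∅ : Cl m) = 1 := rfl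
  unfold gen
  rw [basisElt_mul, basisElt_mul, symmDiff_comm ({k} : Finset (Fin m)) {j}, ← add_smul]
  rcases lt_trichotomy j k with h | h | h
  · simp [sgn, h.ne, h.not_ge, h.le]
  · subst h
    simp only [sgn, symmDiff_self, Finset.prod_singleton, le_refl, if_true, Finset.bot_eq_empty, h1]
    rw [show (-1 + -1 : ℂ) = -2 by norm_num, neg_smul, two_smul, one_add_one_eq_two]
  · simp [sgn, h.ne', h.not_ge, h.le]

/-- `e_{j_1} (e_{j_2} ⋯ e_{j_l}) = e_{j_1} ⋯ e_{j_l}` for `j_1 < ⋯ < j_l`. -/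
lemma gen_mul_basisElt {m : ℕ} (j : Fin m) (T : Finset (Fin m)) (h : ∀ k ∈ T, j < k) :
    gen j * basisElt T = basisElt (insert j T) := by
  have hj : j ∉ T := fun hj => lt_irrefl j (h j hj)
  have h1 : sgn {j} T = 1 := by
    unfold sgn
    rw [Finset.prod_singleton]
    exact Finset.prod_eq_one fun k hk => if_neg (h k hk).not_ge
  have h2 : ({j} : Finset (Fin m)) ∆ T = insert j T := by
    ext k
    simp only [Finset.mem_symmDiff, Finset.mem_singleton, Finset.mem_insert]
    grind
  rw [gen, basisElt_mul, h1, h2, one_smul]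

/-- Clifford conjugation `x̄ = ∑_T (conj x_T) ē_T`, where
`ē_T = (-1)^l e_{j_l} ⋯ e_{j_1} = e_T⁻¹ = sgn T T • e_T`. -/
def conj {m : ℕ} (x : Cl m) : Cl m :=
  WithLp.toLp 2 fun T => sgn T T * (starRingEnd ℂ) (x T)

lemma conj_gen {m : ℕ} (j : Fin m) : conj (gen j) = -gen j := by
  ext T
  by_cases h : T = {j}
  · subst h
    simp [conj, gen, basisElt, sgn]
  · simp [conj, gen, basisElt, h]

lemma conj_add {m : ℕ} (x y : Cl m) : conj (x + y) = conj x + conj y := by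
  ext T
  simp [conj, mul_add]

lemma conj_smul {m : ℕ} (c : ℂ) (x : Cl m) : conj (c • x) = (starRingEnd ℂ) c • conj x := by
  ext T
  simp [conj]
  ring

lemma conj_sgn {m : ℕ} (S T : Finset (Fin m)) : (starRingEnd ℂ) (sgn S T) = sgn S T := by
  unfold sgn
  rw [map_prod]
  refine Finset.prod_congr rfl fun i _ => ?_
  rw [map_prod]
  refine Finset.prod_congr rfl fun j _ => ?_
  split_ifs <;> simp

lemma conj_mul {m : ℕ} (x y : Cl m) : conj (x * y) = conj y * conj x := by
  ext U
  simp only [mul_coord, conj, map_sum, map_mul, conj_sgn, Finset.mul_sum]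
  refine Fintype.sum_equiv ⟨fun S => S ∆ U, fun S => S ∆ U, symmDiff_symmDiff_cancel_right U,
    symmDiff_symmDiff_cancel_right U⟩ _ _ fun S => ?_
  simp only [Equiv.coe_fn_mk, symmDiff_symmDiff_cancel_right]
  have hs : sgn U U * sgn S (S ∆ U) =
      sgn (S ∆ U) S * (sgn (S ∆ U) (S ∆ U) * sgn S S) := by
    simp only [sgn_symmDiff_left, sgn_symmDiff_right]
    linear_combination (-(sgn S U * sgn U U * sgn S S)) *
      (sgn_mul_self U S + (sgn U S * sgn U S) * sgn_mul_self S S)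
  linear_combination ((starRingEnd ℂ) (x S) * (starRingEnd ℂ) (y (S ∆ U))) * hs

/-- `|x|² = Sc (x̄ x)`. -/
lemma conj_mul_self_coord {m : ℕ} (x : Cl m) : (conj x * x) ∅ = ((‖x‖ ^ 2 : ℝ) : ℂ) := by
  rw [EuclideanSpace.norm_sq_eq, mul_coord]
  push_cast
  refine Finset.sum_congr rfl fun S _ => ?_
  have h : S ∆ (∅ : Finset (Fin m)) = S := symmDiff_bot S
  rw [h, ← Complex.conj_mul']
  simp only [conj]
  linear_combination ((starRingEnd ℂ) (x S) * x S) * sgn_mul_self S S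

/-- The quadratic form `v ↦ -∑ v_j²` on `ℂ^m`. -/
def quadForm (m : ℕ) : QuadraticForm ℂ (Fin m → ℂ) :=
  QuadraticMap.weightedSumSquares ℂ fun _ => (-1 : ℂ)

/-- The embedding `ℂ^m → Cl m`, `v ↦ ∑ v_j e_j`. -/
def genMap (m : ℕ) : (Fin m → ℂ) →ₗ[ℂ] Cl m := Fintype.linearCombination ℂ gen

lemma genMap_sq {m : ℕ} (v : Fin m → ℂ) :
    genMap m v * genMap m v = algebraMap ℂ (Cl m) (quadForm m v) := by
  have h1 : genMap m v * genMap m v = ∑ j, ∑ k, (v j * v k) • (gen j * gen k) := by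
    simp only [genMap, Fintype.linearCombination_apply, Finset.sum_mul_sum, smul_mul_smul_comm]
  have h2 : genMap m v * genMap m v = ∑ j, ∑ k, (v j * v k) • (gen k * gen j) := by
    rw [h1, Finset.sum_comm]
    simp only [mul_comm]
  have h3 : (2 : ℂ) • (genMap m v * genMap m v) =
      (2 : ℂ) • algebraMap ℂ (Cl m) (quadForm m v) := by
    rw [two_smul]
    nth_rw 1 [h1]
    rw [h2, ← Finset.sum_add_distrib]
    simp only [← Finset.sum_add_distrib, ← smul_add, gen_mul_add]
    simp only [smul_ite, smul_zero, Finset.sum_ite_eq, Finset.mem_univ, if_true, quadForm,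
      QuadraticMap.weightedSumSquares_apply, map_sum, Finset.smul_sum]
    refine Finset.sum_congr rfl fun j _ => ?_
    rw [Algebra.algebraMap_eq_smul_one, show (-2 : Cl m) = (-2 : ℂ) • (1 : Cl m) by
      rw [neg_smul, two_smul, one_add_one_eq_two], smul_smul, smul_smul]
    congr 1
    simp only [smul_eq_mul]
    ring
  exact smul_right_injective (Cl m) (two_ne_zero (α := ℂ)) h3

/-- The concrete algebra `Cl m` is Mathlib's Clifford algebra of `v ↦ -∑ v_j²` on `ℂ^m`. -/
def cliffordEquiv (m : ℕ) : CliffordAlgebra (quadForm m) ≃ₐ[ℂ] Cl m := by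
  let φ : CliffordAlgebra (quadForm m) →ₐ[ℂ] Cl m :=
    CliffordAlgebra.lift (quadForm m) ⟨genMap m, genMap_sq⟩
  have hgen : ∀ j, gen j ∈ φ.range := fun j =>
    ⟨CliffordAlgebra.ι (quadForm m) (Pi.single j 1), by
      simp [φ, genMap, Fintype.linearCombination_apply_single]⟩
  have hbasis : ∀ T : Finset (Fin m), basisElt T ∈ φ.range := by
    intro T
    induction T using Finset.induction_on_min with
    | empty => exact one_mem φ.range
    | insert j T hj ih =>
      rw [← gen_mul_basisElt j T hj]
      exact mul_mem (hgen j) ih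
  have hsurj : Function.Surjective φ := by
    intro x
    have hx : x = ∑ T, x T • basisElt T := by
      ext U
      rw [WithLp.ofLp_sum, Finset.sum_apply, Finset.sum_eq_single U]
      · simp [basisElt]
      · intro T _ hT
        simp [basisElt, hT.symm]
      · simp
    have hmem : x ∈ φ.range := by
      rw [hx]
      exact Subalgebra.sum_mem _ fun T _ => Subalgebra.smul_mem _ (hbasis T) _
    exact hmem
  have hfin : Module.finrank ℂ (CliffordAlgebra (quadForm m)) = Module.finrank ℂ (Cl m) := by
    let _ : Invertible (2 : ℂ) := invertibleOfNonzero two_ne_zero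
    rw [(CliffordAlgebra.equivExterior (quadForm m)).finrank_eq,
      Module.finrank_eq_card_basis (Pi.basisFun ℂ (Fin m)).ExteriorAlgebra, finrank_euclideanSpace]
  haveI : FiniteDimensional ℂ (CliffordAlgebra (quadForm m)) := by
    let _ : Invertible (2 : ℂ) := invertibleOfNonzero two_ne_zero
    exact Module.Finite.of_basis ((Pi.basisFun ℂ (Fin m)).ExteriorAlgebra.map
      (CliffordAlgebra.equivExterior (quadForm m)).symm)
  have hinj : Function.Injective φ :=
    (LinearMap.injective_iff_surjective_of_finrank_eq_finrank (f := φ.toLinearMap) hfin).2 hsurj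
  exact AlgEquiv.ofBijective φ ⟨hinj, hsurj⟩

/-! ### Half-spaces, monogenic functions, Hardy and Bergman spaces -/

/-- `ℝ^m`. -/
abbrev Vec (m : ℕ) : Type := EuclideanSpace ℝ (Fin m)

/-- `ℝ^(m+1)`: the pair `(x₀, x̲)` is the para-vector `x = x₀ + x̲`. -/
abbrev ParaVec (m : ℕ) : Type := ℝ × Vec m

/-- The vector `ξ = ∑ ξ_j e_j` as an element of the Clifford algebra. -/
def vec {m : ℕ} (ξ : Vec m) : Cl m := ∑ j, (ξ j : ℂ) • gen j

/-- The conjugate `x̄ = x₀ - x̲` of a para-vector. -/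
def paraConj {m : ℕ} (x : ParaVec m) : ParaVec m := (x.1, -x.2)

/-- The half-space `{x₀ > -a}` for `ε = 1`, and `{x₀ < a}` for `ε = -1`. -/
def halfSpace (m : ℕ) (ε a : ℝ) : Set (ParaVec m) := {x | -a < ε * x.1}

/-- The Dirac operator `D f = ∑_{k=0}^m e_k ∂_k f`, with `e_0 = 1`. -/
def dirac {m : ℕ} (f : ParaVec m → Cl m) (x : ParaVec m) : Cl m :=
  fderiv ℝ f x (1, 0) + ∑ k, gen k * fderiv ℝ f x (0, EuclideanSpace.single k 1)

/-- `f` is left-monogenic in the open set `Ω`. -/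
def IsLeftMonogenic {m : ℕ} (f : ParaVec m → Cl m) (Ω : Set (ParaVec m)) : Prop :=
  ContDiffOn ℝ 1 f Ω ∧ ∀ x ∈ Ω, dirac f x = 0

/-- `f` belongs to the Hardy space `H²` of the half-space. -/
def MemHardy {m : ℕ} (ε a : ℝ) (f : ParaVec m → Cl m) : Prop :=
  IsLeftMonogenic f (halfSpace m ε a) ∧
    (⨆ t ∈ {t : ℝ | -a < ε * t}, ∫⁻ y : Vec m, ‖f (t, y)‖ₑ ^ 2) < ⊤

/-- `f` belongs to the Bergman space `A²` of the half-space. -/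
def MemBergman {m : ℕ} (ε a : ℝ) (f : ParaVec m → Cl m) : Prop :=
  IsLeftMonogenic f (halfSpace m ε a) ∧
    (∫⁻ t in {t : ℝ | -a < ε * t}, ∫⁻ y : Vec m, ‖f (t, y)‖ₑ ^ 2) < ⊤

/-- `S` is the Szegő kernel of the half-space, the reproducing kernel of its Hardy space `H²`:
`S(·, x) ∈ H²`, and `f(x) = ⟨f, S(·, x)⟩` for `f ∈ H²`, where `⟨f, h⟩ = ∫ h̄ f` is
the inner product in `L²(ℝ^m)` of the boundary values on the hyperplane `x₀ = -ε a`, that is, the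
limit of the inner products on the parallel hyperplanes. -/
def IsSzegoKernel {m : ℕ} (ε a : ℝ) (S : ParaVec m → ParaVec m → Cl m) : Prop :=
  ∀ x ∈ halfSpace m ε a, MemHardy ε a (fun w => S w x) ∧
    ∀ f : ParaVec m → Cl m, MemHardy ε a f →
      Filter.Tendsto (fun t : ℝ => ∫ y : Vec m, conj (S (t, y) x) * f (t, y))
        (nhdsWithin (-(ε * a)) {t : ℝ | -a < ε * t}) (nhds (f x))

/-- `B` is the Bergman kernel of the half-space, the reproducing kernel of its Bergman space `A²`
with respect to `⟨f, h⟩ = ∫ h̄ f`. -/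
def IsBergmanKernel {m : ℕ} (ε a : ℝ) (B : ParaVec m → ParaVec m → Cl m) : Prop :=
  ∀ x ∈ halfSpace m ε a, MemBergman ε a (fun w => B w x) ∧
    ∀ f : ParaVec m → Cl m, MemBergman ε a f →
      f x = ∫ w in halfSpace m ε a, conj (B w x) * f w

/-! ### The monogenic exponentials and the Fourier transform -/

/-- `χ_±(ξ) = (1 ± i ξ/|ξ|) / 2`, for `ε = ±1`. -/
def chi {m : ℕ} (ε : ℝ) (ξ : Vec m) : Cl m :=
  (1 / 2 : ℂ) • (1 + (ε * Complex.I / ‖ξ‖ : ℂ) • vec ξ)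

/-- `e^±(x, ξ) = e^{i⟨x̲, ξ⟩} e^{∓ x₀ |ξ|} χ_±(ξ)`, for `ε = ±1`. -/
def monExp {m : ℕ} (ε : ℝ) (x : ParaVec m) (ξ : Vec m) : Cl m :=
  (Complex.exp (Complex.I * (inner ℝ x.2 ξ : ℝ)) * Real.exp (-(ε * x.1 * ‖ξ‖)) : ℂ) • chi ε ξ

/-- `h ∈ L²(ℝ^m)`, and `g = F h` almost everywhere, where `F` is the extension to `L²` of
`F h(ξ) = ∫ e^{-i⟨x, ξ⟩} h(x) dx`. Mathlib's transform has `e^{-2πi⟨x, ξ⟩}` in place of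
`e^{-i⟨x, ξ⟩}`, hence the dilation. -/
def IsFourierTransformL2 {m : ℕ} (h g : Vec m → Cl m) : Prop :=
  ∃ hh : MeasureTheory.MemLp h 2 MeasureTheory.volume,
    g =ᵐ[MeasureTheory.volume] fun ξ =>
      (FourierTransform.fourier (hh.toLp h) : MeasureTheory.Lp (Cl m) 2 MeasureTheory.volume)
        ((2 * Real.pi)⁻¹ • ξ)

end

end CliffordHalfSpace

open CliffordHalfSpace

open MeasureTheory Filter Topology FourierTransform

open scoped ContDiff SchwartzMap symmDiff ENNReal

namespace CliffordHalfSpace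

/-! Formally, the Fourier transform `g_t` of the slice `f(t, ·)` of a left-monogenic `f` solves `∂_t
g_t = -iξ g_t`. Since `ξ² = -|ξ|²`, left multiplication by `iξ` has eigenvalues `±|ξ|` with
projections `χ_±`, so `e^{σt|ξ|} χ_σ g_t` is independent of `t` for `σ = ±1`.

This is proved weakly, without differentiating `g_t`. Reflecting and conjugating a superposition of
exponentials over a compact set `K` gives a right-monogenic test function
(`isRightMonogenic_dualTest`). By Cauchy's theorem with cutoffs (`integral_slice_eq`) its pairing
with the slices of `f` does not depend on the slice; by Parseval this pairing is a constant times
`∫_K e^{σt|ξ|} χ_σ g_t`. As `K` is arbitrary, `chi_mul_fourier_ae_eq` follows. Going to infinity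
inside the half-space kills the growing component `χ_{-ε} g_t`, because slices of bounded norm occur
arbitrarily far out, as both the Hardy and the Bergman condition guarantee. What remains is a
superposition of the exponentials `e^ε` (`exists_monInt_eq`).

For such a superposition, Plancherel on slices and integration in `t` give the Bergman norm, with
weight `∫ e^{-2εt|ξ|} dt = e^{2a|ξ|}/(2|ξ|)`; this is the characterization of `A²`. Pairing the
slice at `t` with a kernel of weight `p` multiplies the density of `f(x)` by `e^{-2εt|ξ|} p(ξ)`
(`integral_conj_expKernel_mul`). The reproducing property asks that this factor become `1`: in the
limit `t → -εa` for Szegő, so `p = e^{-2a|ξ|}`; after integration over `t` for Bergman, so `p =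
2|ξ|e^{-2a|ξ|}`. Uniqueness is the Hermitian symmetry obtained by applying two reproducing kernels
to each other, and `B = ∓2 ∂S/∂x₀` holds because `∂/∂x₀` multiplies the exponential by `∓|ξ|`. -/

variable {m : ℕ}

/-! ### The `L²` Fourier transform of vector-valued functions -/

section FourierL2

variable {V F : Type*} [NormedAddCommGroup V] [InnerProductSpace ℝ V] [FiniteDimensional ℝ V]
  [MeasurableSpace V] [BorelSpace V] [NormedAddCommGroup F] [InnerProductSpace ℂ F]
  [CompleteSpace F]

/-- The `L²` inverse Fourier transform is given by the integral on `L¹ ∩ L²`. -/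
lemma fourierInv_toLp_ae_eq {k : V → F} (h1 : Integrable k) (h2 : MemLp k 2) :
    (𝓕⁻ (h2.toLp k) : Lp F 2 (volume : Measure V)) =ᵐ[volume] 𝓕⁻ k := by
  have hcont : Continuous (𝓕⁻ k) :=
    VectorFourier.fourierIntegral_continuous Real.continuous_fourierChar
      (L := -innerₗ V) (by simpa using! continuous_inner.neg) h1
  -- Both sides are locally integrable, so testing against smooth compactly supported functions
  -- suffices. On the `L²` side the transform moves to the test function by duality of tempered
  -- distributions, on the `L¹` side by Fubini.
  refine ae_eq_of_integral_contDiff_smul_eq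
    ((Lp.memLp _).locallyIntegrable (by norm_num)) hcont.locallyIntegrable fun g gs gc => ?_
  have hg₁ : HasCompactSupport (Complex.ofRealCLM ∘ g) := gc.comp_left rfl
  have hg₂ : ContDiff ℝ ∞ (Complex.ofRealCLM ∘ g) := by fun_prop
  set G := hg₁.toSchwartzMap hg₂ with hG
  have e1 : ∫ x, g x • (𝓕⁻ (h2.toLp k) : Lp F 2 (volume : Measure V)) x =
      Lp.toTemperedDistribution (𝓕⁻ (h2.toLp k)) G := by
    simp [hG]
  rw [e1, ← Lp.fourierInv_toTemperedDistribution_eq, TemperedDistribution.fourierInv_apply,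
    Lp.toTemperedDistribution_apply]
  have e2 : ∫ x, (𝓕⁻ G) x • (h2.toLp k) x = ∫ x, (𝓕⁻ (G : V → ℂ)) x • k x := by
    refine integral_congr_ae ?_
    filter_upwards [h2.coeFn_toLp] with x hx
    rw [hx, SchwartzMap.fourierInv_coe]
  rw [e2]
  have := VectorFourier.integral_fourierIntegral_smul_eq_flip (μ := volume) (ν := volume)
    (L := -innerₗ V) (f := (G : V → ℂ)) (g := k)
    Real.continuous_fourierChar (by simpa using! continuous_inner.neg) G.integrable h1
  have hflip : (-innerₗ V).flip = -innerₗ V := by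
    ext x y
    simp [real_inner_comm]
  rw [hflip] at this
  refine this.trans ?_
  refine integral_congr_ae (ae_of_all _ fun x => ?_)
  simp [hG]
  rfl

/-- The `L²` Fourier transform commutes with continuous linear maps acting on the values. -/
lemma fourier_compLp (A : F →L[ℂ] F) (f : Lp F 2 (volume : Measure V)) :
    𝓕 (A.compLp f) = A.compLp (𝓕 f) := by
  refine DenseRange.induction_on (p := fun f : Lp F 2 (volume : Measure V) =>
    𝓕 (A.compLp f) = A.compLp (𝓕 f))
    (SchwartzMap.denseRange_toLpCLM (E := V) (F := F) (p := 2) ENNReal.ofNat_ne_top) f ?_ ?_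
  · refine isClosed_eq ?_ ?_
    · exact (Lp.fourierTransformₗᵢ V F).continuous.comp (A.compLpL 2 volume).continuous
    · exact (A.compLpL 2 volume).continuous.comp (Lp.fourierTransformₗᵢ V F).continuous
  · intro g
    rw [SchwartzMap.toLpCLM_apply, SchwartzMap.toLp_fourier_eq]
    -- For Schwartz `g` the function `A ∘ 𝓕 g` is in `L¹ ∩ L²`, so its inverse transform is a
    -- genuine integral, and `A` passes through the integral.
    have hk1 : Integrable (fun x => A ((𝓕 g) x)) := A.integrable_comp (𝓕 g).integrable
    have hk2 : MemLp (fun x => A ((𝓕 g) x)) 2 := A.comp_memLp' ((𝓕 g).memLp 2)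
    have h1 := fourierInv_toLp_ae_eq hk1 hk2
    have h2 : A.compLp (g.toLp 2 volume) = 𝓕⁻ (hk2.toLp _) := by
      refine Lp.ext ?_
      filter_upwards [A.coeFn_compLp (g.toLp 2 volume), g.coeFn_toLp 2 volume, h1] with x a b c
      rw [a, b, c]
      have h3 : g x = (𝓕⁻ (𝓕 g)) x := by simp
      rw [h3, SchwartzMap.fourierInv_coe, Real.fourierInv_eq, Real.fourierInv_eq,
        ← A.integral_comp_comm]
      · simp
      · have := (VectorFourier.fourierIntegral_convergent_iff (μ := volume) (L := -innerₗ V)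
          Real.continuous_fourierChar (by simpa using! continuous_inner.neg) x).2 (𝓕 g).integrable
        simpa using! this
    rw [h2, fourier_fourierInv_eq]
    refine Lp.ext ?_
    filter_upwards [hk2.coeFn_toLp, A.coeFn_compLp ((𝓕 g).toLp 2 volume),
      (𝓕 g).coeFn_toLp 2 volume] with x a b c
    rw [a, b, c]

end FourierL2

/-! ### Algebra -/

lemma real_smul_eq (r : ℝ) (x : Cl m) : r • x = (r : ℂ) • x := by
  ext T
  simp

lemma real_smul_mul (r : ℝ) (x y : Cl m) : (r • x) * y = r • (x * y) := by
  rw [real_smul_eq, real_smul_eq, smul_mul_assoc]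

lemma mul_real_smul (r : ℝ) (x y : Cl m) : x * (r • y) = r • (x * y) := by
  rw [real_smul_eq, real_smul_eq, mul_smul_comm]

/-- Multiplication of the Clifford algebra as a continuous complex bilinear map. -/
noncomputable def mulC (m : ℕ) : Cl m →L[ℂ] Cl m →L[ℂ] Cl m :=
  LinearMap.toContinuousLinearMap
    (LinearMap.toContinuousLinearMap.toLinearMap ∘ₗ LinearMap.mul ℂ (Cl m))

/-- Multiplication of the Clifford algebra as a continuous real bilinear map. -/
noncomputable def mulR (m : ℕ) : Cl m →L[ℝ] Cl m →L[ℝ] Cl m :=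
  (ContinuousLinearMap.restrictScalarsL ℂ (Cl m) (Cl m) ℝ ℝ).comp
    ((mulC m).restrictScalars ℝ)

lemma norm_mul_le_const (x y : Cl m) : ‖x * y‖ ≤ ‖mulC m‖ * ‖x‖ * ‖y‖ :=
  (mulC m).le_opNorm₂ x y

lemma continuous_cl_mul : Continuous fun p : Cl m × Cl m => p.1 * p.2 :=
  (mulC m).continuous₂

instance : ContinuousMul (Cl m) := ⟨continuous_cl_mul⟩

lemma conj_conj (x : Cl m) : conj (conj x) = x := by
  ext T
  simp only [conj, map_mul, conj_sgn, Complex.conj_conj]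
  rw [← mul_assoc, sgn_mul_self, one_mul]

lemma norm_sgn (S T : Finset (Fin m)) : ‖sgn S T‖ = 1 := by
  have := congrArg norm (sgn_mul_self S T)
  rw [norm_mul, norm_one] at this
  nlinarith [norm_nonneg (sgn S T)]

lemma norm_conj (x : Cl m) : ‖conj x‖ = ‖x‖ := by
  simp [EuclideanSpace.norm_eq, conj, norm_sgn]

lemma conj_real_smul (r : ℝ) (x : Cl m) : conj (r • x) = r • conj x := by
  rw [real_smul_eq, real_smul_eq, conj_smul, Complex.conj_ofReal]

/-- Conjugation as a real linear isometry. -/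
noncomputable def conjL (m : ℕ) : Cl m ≃ₗᵢ[ℝ] Cl m where
  toFun := conj
  invFun := conj
  left_inv := conj_conj
  right_inv := conj_conj
  map_add' := conj_add
  map_smul' := conj_real_smul
  norm_map' := norm_conj

lemma conj_basisElt (U : Finset (Fin m)) : conj (basisElt U) = sgn U U • basisElt U := by
  ext T
  by_cases h : T = U
  · subst h
    simp [conj, basisElt]
  · simp [conj, basisElt, h]

/-- The scalar part of `conj x * y` is the Hermitian inner product, and any other coordinate is the
scalar part after multiplying on the left by `conj e_U`, that is, after replacing `x` by `x e_U`.
This reduces Clifford-valued Parseval identities to scalar ones. -/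
lemma conj_mul_coord (x y : Cl m) (U : Finset (Fin m)) :
    (conj x * y) U = inner ℂ (x * basisElt U) y := by
  have h1 : ∀ x y : Cl m, (conj x * y) ∅ = inner ℂ x y := by
    intro x y
    rw [mul_coord, PiLp.inner_apply]
    refine Finset.sum_congr rfl fun S _ => ?_
    have h : S ∆ (∅ : Finset (Fin m)) = S := symmDiff_bot S
    rw [h]
    simp only [conj, RCLike.inner_apply]
    linear_combination ((starRingEnd ℂ) (x S) * y S) * sgn_mul_self S S
  rw [← h1, conj_mul, mul_assoc, conj_basisElt, smul_mul_assoc]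
  generalize conj x * y = z
  rw [PiLp.smul_apply, mul_coord, Finset.sum_eq_single U]
  · have h : U ∆ (∅ : Finset (Fin m)) = U := symmDiff_bot U
    rw [h]
    simp [basisElt, ← mul_assoc, sgn_mul_self]
  · intro S _ hS
    simp [basisElt, hS]
  · simp

lemma vec_eq_genMap (ξ : Vec m) : vec ξ = genMap m (fun j => (ξ j : ℂ)) := by
  simp [vec, genMap, Fintype.linearCombination_apply]

lemma vec_mul_self (ξ : Vec m) : vec ξ * vec ξ = (-(‖ξ‖ : ℂ) ^ 2) • (1 : Cl m) := by
  rw [vec_eq_genMap, genMap_sq, Algebra.algebraMap_eq_smul_one]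
  congr 1
  rw [quadForm, QuadraticMap.weightedSumSquares_apply, ← Complex.ofReal_pow,
    EuclideanSpace.norm_sq_eq]
  push_cast
  rw [← Finset.sum_neg_distrib]
  refine Finset.sum_congr rfl fun j _ => ?_
  rw [← Complex.ofReal_pow, Real.norm_eq_abs, sq_abs]
  simp [sq]

lemma conj_sum {ι : Type*} (s : Finset ι) (f : ι → Cl m) :
    conj (∑ i ∈ s, f i) = ∑ i ∈ s, conj (f i) := map_sum (conjL m) f s

lemma conj_neg (x : Cl m) : conj (-x) = -conj x := map_neg (conjL m) x

lemma conj_vec (ξ : Vec m) : conj (vec ξ) = -vec ξ := by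
  simp only [vec, conj_sum, conj_smul, conj_gen, Complex.conj_ofReal, smul_neg,
    Finset.sum_neg_distrib]

lemma conj_one : conj (1 : Cl m) = 1 := by
  have h : (1 : Cl m) = basisElt ∅ := rfl
  rw [h, conj_basisElt]
  simp [sgn]

/-- `vec` as a continuous linear map. -/
noncomputable def vecL (m : ℕ) : Vec m →L[ℝ] Cl m :=
  LinearMap.toContinuousLinearMap
    { toFun := vec
      map_add' := fun x y => by
        simp [vec, add_smul, Finset.sum_add_distrib]
      map_smul' := fun r x => by
        rw [RingHom.id_apply, real_smul_eq, vec, vec, Finset.smul_sum]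
        refine Finset.sum_congr rfl fun j _ => ?_
        rw [smul_smul, PiLp.smul_apply, smul_eq_mul, Complex.ofReal_mul] }

lemma continuous_vec : Continuous (vec (m := m)) := (vecL m).continuous

lemma norm_vec_le (ξ : Vec m) : ‖vec ξ‖ ≤ ‖vecL m‖ * ‖ξ‖ := (vecL m).le_opNorm ξ

lemma measurable_chi (ε : ℝ) : Measurable (chi (m := m) ε) := by
  unfold chi
  have h1 : Measurable (vec (m := m)) := continuous_vec.measurable
  have h2 : Measurable fun ξ : Vec m => (ε * Complex.I / ‖ξ‖ : ℂ) := by fun_prop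
  exact ((h2.smul h1).const_add (1 : Cl m)).const_smul (1 / 2 : ℂ)

lemma chi_add_chi_neg (ε : ℝ) (ξ : Vec m) : chi ε ξ + chi (-ε) ξ = 1 := by
  rw [chi, chi, ← smul_add]
  have : (1 + (ε * Complex.I / ‖ξ‖ : ℂ) • vec ξ + (1 + (((-ε : ℝ) : ℂ) * Complex.I / ‖ξ‖ : ℂ) • vec ξ))
      = (2 : ℂ) • (1 : Cl m) := by
    push_cast
    rw [neg_mul, neg_div, neg_smul, two_smul]
    abel
  rw [this, smul_smul]
  norm_num

lemma conj_chi (ε : ℝ) (ξ : Vec m) : conj (chi ε ξ) = chi ε ξ := by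
  rw [chi, conj_smul, conj_add, conj_smul, conj_vec, conj_one]
  congr 1
  · simp [Complex.conj_ofNat]
  · simp only [map_div₀, map_mul, Complex.conj_ofReal, Complex.conj_I, smul_neg, ← neg_smul]
    congr 2
    ring

/-- Since `(iξ)² = |ξ|²`, the element `1 + ε iξ/|ξ|` is an eigenvector of left multiplication by
`iξ` with eigenvalue `ε|ξ|`. This is what makes the exponentials monogenic. -/
lemma I_vec_mul_chi {ε : ℝ} (hε : ε = 1 ∨ ε = -1) {ξ : Vec m} :
    (Complex.I • vec ξ) * chi ε ξ = ((ε * ‖ξ‖ : ℝ) : ℂ) • chi ε ξ := by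
  have he : ε * ε = 1 := by rcases hε with h | h <;> simp [h]
  have he' : (ε : ℂ) * ε = 1 := by exact_mod_cast he
  by_cases h0 : ξ = 0
  · subst h0
    have : vec (0 : Vec m) = 0 := by simp [vec]
    simp [this]
  have hξ : (‖ξ‖ : ℂ) ≠ 0 := by exact_mod_cast norm_ne_zero_iff.2 h0
  rw [chi, mul_smul_comm, mul_add, mul_one, smul_mul_smul_comm, vec_mul_self, smul_comm _ (1 / 2 : ℂ),
    add_comm, smul_smul]
  rw [← sub_eq_zero]
  simp only [smul_add, smul_smul]
  rw [add_sub_add_comm, ← sub_smul, ← sub_smul]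
  have h1 : (1 / 2 * (Complex.I * (ε * Complex.I / ‖ξ‖)) * -(‖ξ‖ : ℂ) ^ 2 -
      1 / 2 * ((ε * ‖ξ‖ : ℝ) : ℂ)) = 0 := by
    push_cast
    field_simp
    linear_combination (-(ε : ℂ) * ‖ξ‖) * Complex.I_sq
  have h2 : (1 / 2 * Complex.I - 1 / 2 * ((ε * ‖ξ‖ : ℝ) : ℂ) * (ε * Complex.I / ‖ξ‖) : ℂ) = 0 := by
    push_cast
    field_simp
    linear_combination -Complex.I * he'
  simp only [mul_assoc] at h1 h2 ⊢
  rw [h1, h2, zero_smul, zero_smul, add_zero]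

/-- At `ξ = 0` division by zero makes `chi` equal to `1/2`, which is not idempotent; later uses
discard the origin as a null set, which requires `m ≥ 1`. -/
lemma chi_mul_self {ε : ℝ} (hε : ε = 1 ∨ ε = -1) {ξ : Vec m} (hξ : ξ ≠ 0) :
    chi ε ξ * chi ε ξ = chi ε ξ := by
  have he : ε * ε = 1 := by rcases hε with h | h <;> simp [h]
  have he' : (ε : ℂ) * ε = 1 := by exact_mod_cast he
  have hξ : (‖ξ‖ : ℂ) ≠ 0 := by exact_mod_cast norm_ne_zero_iff.2 hξ
  have h1 : chi ε ξ = (1 / 2 : ℂ) • (1 + (ε / ‖ξ‖ : ℂ) • (Complex.I • vec ξ)) := by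
    rw [chi, smul_smul]
    congr 3
    ring
  nth_rw 1 [h1]
  rw [smul_mul_assoc, add_mul, smul_mul_assoc, I_vec_mul_chi hε, one_mul, smul_smul]
  have : (ε / ‖ξ‖ * ((ε * ‖ξ‖ : ℝ) : ℂ) : ℂ) = 1 := by
    push_cast
    field_simp
    linear_combination he'
  rw [this, one_smul, ← two_smul ℂ (chi ε ξ), smul_smul]
  norm_num

/-- A bound for the norm of multiplication by `chi`. -/
noncomputable def chiBound (m : ℕ) : ℝ :=
  ‖mulC m‖ * (1 / 2 * (‖(1 : Cl m)‖ + ‖vecL m‖))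

lemma norm_chi_le {ε : ℝ} (hε : ε = 1 ∨ ε = -1) (ξ : Vec m) :
    ‖chi ε ξ‖ ≤ 1 / 2 * (‖(1 : Cl m)‖ + ‖vecL m‖) := by
  rw [chi, norm_smul]
  have he : |ε| = 1 := by rcases hε with h | h <;> simp [h]
  have h2 : ‖(ε * Complex.I / ‖ξ‖ : ℂ) • vec ξ‖ ≤ ‖vecL m‖ := by
    rw [norm_smul]
    simp only [norm_div, norm_mul, Complex.norm_real, Complex.norm_I, Real.norm_eq_abs, abs_norm,
      he, mul_one]
    by_cases h0 : ξ = 0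
    · simp [h0]
    · have := norm_vec_le ξ
      have hp : 0 < ‖ξ‖ := norm_pos_iff.2 h0
      rw [div_mul_eq_mul_div, one_mul, div_le_iff₀ hp]
      exact this
  have := norm_add_le (1 : Cl m) ((ε * Complex.I / ‖ξ‖ : ℂ) • vec ξ)
  norm_num
  linarith

lemma chiBound_nonneg (m : ℕ) : 0 ≤ chiBound m := by
  unfold chiBound
  positivity

lemma norm_chi_mul_le {ε : ℝ} (hε : ε = 1 ∨ ε = -1) (ξ : Vec m) (x : Cl m) :
    ‖chi ε ξ * x‖ ≤ chiBound m * ‖x‖ := by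
  refine (norm_mul_le_const _ _).trans ?_
  unfold chiBound
  gcongr
  exact norm_chi_le hε ξ

/-! ### The `L²` Fourier transform -/

lemma lintegral_comp_smul_vec (F : Vec m → ℝ≥0∞) {r : ℝ} (hr : 0 < r) :
    ∫⁻ x : Vec m, F (r • x) = ENNReal.ofReal ((r ^ m)⁻¹) * ∫⁻ x, F x := by
  have hme : MeasurableEmbedding fun x : Vec m => r • x :=
    (Homeomorph.smulOfNeZero r hr.ne').measurableEmbedding
  rw [← hme.lintegral_map, Measure.map_addHaar_smul volume hr.ne', lintegral_smul_measure,
    finrank_euclideanSpace_fin, abs_of_pos (by positivity), smul_eq_mul]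

lemma MemLp.comp_smul_vec {g : Vec m → Cl m} (hg : MemLp g 2) {r : ℝ} (hr : 0 < r) :
    MemLp (fun x => g (r • x)) 2 := by
  have hme : MeasurableEmbedding fun x : Vec m => r • x :=
    (Homeomorph.smulOfNeZero r hr.ne').measurableEmbedding
  have : MemLp g 2 (Measure.map (fun x : Vec m => r • x) volume) := by
    rw [Measure.map_addHaar_smul volume hr.ne']
    exact hg.smul_measure ENNReal.ofReal_ne_top
  exact hme.memLp_map_measure_iff.1 this

lemma lintegral_enorm_sq_eq {α : Type*} [MeasurableSpace α] {μ : Measure α} (h : α → Cl m) :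
    ∫⁻ x, ‖h x‖ₑ ^ 2 ∂μ = eLpNorm h 2 μ ^ 2 := by
  rw [eLpNorm_eq_lintegral_rpow_enorm_toReal (by norm_num) (by norm_num), ← ENNReal.rpow_natCast,
    ← ENNReal.rpow_mul]
  norm_num

lemma memLp_two_iff {α : Type*} [MeasurableSpace α] {μ : Measure α} {h : α → Cl m}
    (hm : AEStronglyMeasurable h μ) : MemLp h 2 μ ↔ ∫⁻ x, ‖h x‖ₑ ^ 2 ∂μ < ⊤ := by
  rw [lintegral_enorm_sq_eq]
  refine ⟨fun h => ENNReal.pow_lt_top h.2, fun h => ⟨hm, ?_⟩⟩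
  rcases ENNReal.pow_lt_top_iff.1 h with h | h
  · exact h
  · simp at h

lemma exists_isFourierTransformL2 {h : Vec m → Cl m} (hh : MemLp h 2) :
    ∃ g : Vec m → Cl m, IsFourierTransformL2 h g :=
  ⟨_, hh, EventuallyEq.rfl⟩

lemma IsFourierTransformL2.memLp_right {h g : Vec m → Cl m} (H : IsFourierTransformL2 h g) :
    MemLp g 2 := by
  obtain ⟨hh, hg⟩ := H
  exact (MemLp.comp_smul_vec (Lp.memLp _) (by positivity)).ae_eq hg.symm

lemma IsFourierTransformL2.congr_right {h g g' : Vec m → Cl m} (H : IsFourierTransformL2 h g)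
    (hg : g =ᵐ[volume] g') : IsFourierTransformL2 h g' :=
  ⟨H.1, hg.symm.trans H.2⟩

lemma IsFourierTransformL2.congr_left {h h' g : Vec m → Cl m} (H : IsFourierTransformL2 h g)
    (hh : h =ᵐ[volume] h') : IsFourierTransformL2 h' g := by
  obtain ⟨h1, h2⟩ := H
  refine ⟨h1.ae_eq hh, h2.trans ?_⟩
  have : (h1.ae_eq hh).toLp h' = h1.toLp h := (MemLp.toLp_eq_toLp_iff _ _).2 hh.symm
  rw [this]

lemma IsFourierTransformL2.fourier_ae_eq {h g : Vec m → Cl m} (H : IsFourierTransformL2 h g) :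
    (𝓕 (H.1.toLp h) : Lp (Cl m) 2 (volume : Measure (Vec m))) =ᵐ[volume]
      fun η => g ((2 * Real.pi) • η) := by
  have hq := Measure.quasiMeasurePreserving_smul (volume : Measure (Vec m))
    (r := 2 * Real.pi) (by positivity)
  filter_upwards [hq.ae H.2] with η hη
  rw [hη, smul_smul, inv_mul_cancel₀ (by positivity), one_smul]

lemma IsFourierTransformL2.ae_eq_left {h h' g : Vec m → Cl m} (H : IsFourierTransformL2 h g)
    (H' : IsFourierTransformL2 h' g) : h =ᵐ[volume] h' := by
  have h1 : (𝓕 (H.1.toLp h) : Lp (Cl m) 2 (volume : Measure (Vec m))) = 𝓕 (H'.1.toLp h') :=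
    Lp.ext (H.fourier_ae_eq.trans H'.fourier_ae_eq.symm)
  have h2 := (Lp.fourierTransformₗᵢ (Vec m) (Cl m)).injective h1
  exact (MemLp.toLp_eq_toLp_iff _ _).1 h2

/-- Plancherel's theorem. -/
lemma IsFourierTransformL2.lintegral_eq {h g : Vec m → Cl m} (H : IsFourierTransformL2 h g) :
    ∫⁻ y, ‖h y‖ₑ ^ 2 = ENNReal.ofReal (((2 * Real.pi) ^ m)⁻¹) * ∫⁻ ξ, ‖g ξ‖ₑ ^ 2 := by
  rw [← lintegral_comp_smul_vec (fun ξ => ‖g ξ‖ₑ ^ 2) (by positivity : (0 : ℝ) < 2 * Real.pi),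
    lintegral_enorm_sq_eq, lintegral_enorm_sq_eq, ← eLpNorm_congr_ae H.fourier_ae_eq,
    ← eLpNorm_congr_ae H.1.coeFn_toLp]
  have := Lp.norm_fourier_eq (H.1.toLp h)
  rw [Lp.norm_def, Lp.norm_def,
    ENNReal.toReal_eq_toReal_iff' (Lp.eLpNorm_ne_top _) (Lp.eLpNorm_ne_top _)] at this
  rw [this]

lemma continuous_conj : Continuous (conj (m := m)) := (conjL m).continuous

lemma integrable_conj_mul {α : Type*} [MeasurableSpace α] {μ : Measure α} {h f : α → Cl m}
    (hh : MemLp h 2 μ) (hf : MemLp f 2 μ) : Integrable (fun x => conj (h x) * f x) μ := by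
  have h1 : AEStronglyMeasurable (fun x => conj (h x) * f x) μ :=
    (continuous_conj.comp_aestronglyMeasurable hh.1).mul hf.1
  have h2 : Integrable (fun x => ‖h x‖ * ‖f x‖) μ := MemLp.integrable_mul hh.norm hf.norm
  refine (h2.const_mul ‖mulC m‖).mono' h1 (ae_of_all _ fun x => ?_)
  have h3 := norm_mul_le_const (conj (h x)) (f x)
  rw [norm_conj, mul_assoc] at h3
  exact h3

/-- Parseval's formula. -/
lemma IsFourierTransformL2.integral_conj_mul {h g h' g' : Vec m → Cl m}
    (H : IsFourierTransformL2 h g) (H' : IsFourierTransformL2 h' g') :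
    ∫ y, conj (h y) * h' y = ((2 * Real.pi) ^ m)⁻¹ • ∫ ξ, conj (g ξ) * g' ξ := by
  have hpi : (0 : ℝ) < 2 * Real.pi := by positivity
  have hs := Measure.integral_comp_smul_of_nonneg (volume : Measure (Vec m))
    (fun ξ => conj (g ξ) * g' ξ) (2 * Real.pi) (hR := hpi.le)
  rw [finrank_euclideanSpace_fin] at hs
  rw [← hs]
  ext U
  have h1 : ∀ {h f : Vec m → Cl m}, MemLp h 2 → MemLp f 2 →
      (∫ y, conj (h y) * f y) U = ∫ y, inner ℂ (h y * basisElt U) (f y) := by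
    intro h f hh hf
    have := ((EuclideanSpace.proj (𝕜 := ℂ) U : Cl m →L[ℂ] ℂ)).integral_comp_comm
      (integrable_conj_mul hh hf)
    simp only [EuclideanSpace.coe_proj, conj_mul_coord] at this
    exact this.symm
  rw [h1 H.1 H'.1, h1 (MemLp.comp_smul_vec H.memLp_right hpi)
    (MemLp.comp_smul_vec H'.memLp_right hpi)]
  -- Right multiplication by `e_U` commutes with the transform by `fourier_compLp`, so the
  -- coordinate `U` of the pairing is an ordinary `L²` inner product.
  set A : Cl m →L[ℂ] Cl m := (mulC m).flip (basisElt U)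
  have h2 := Lp.inner_fourier_eq (A.compLp (H.1.toLp h)) (H'.1.toLp h')
  rw [fourier_compLp, L2.inner_def, L2.inner_def] at h2
  refine Eq.trans (Eq.trans ?_ h2.symm) ?_
  · refine integral_congr_ae ?_
    filter_upwards [A.coeFn_compLp (H.1.toLp h), H.1.coeFn_toLp, H'.1.coeFn_toLp] with x a b c
    rw [a, b, c]
    rfl
  · refine integral_congr_ae ?_
    filter_upwards [A.coeFn_compLp (𝓕 (H.1.toLp h)), H.fourier_ae_eq, H'.fourier_ae_eq]
      with x a b c
    rw [a, b, c]
    rfl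

/-- The inverse Fourier transform of an integrable, square integrable function. -/
lemma isFourierTransformL2_of_integrable {c : Vec m → Cl m} (h1 : Integrable c)
    (h2 : MemLp c 2) :
    IsFourierTransformL2 (fun y => (1 / (2 * Real.pi) ^ m : ℝ) •
      ∫ ξ : Vec m, Complex.exp (Complex.I * (inner ℝ y ξ : ℝ)) • c ξ) c := by
  have hpi : (0 : ℝ) < 2 * Real.pi := by positivity
  -- The dilation by `2π` passes to the normalization `e^{2πi⟨y, η⟩}`; its Jacobian is the factor
  -- `(2π)^{-m}`.
  set k : Vec m → Cl m := fun η => c ((2 * Real.pi) • η) with hk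
  have k1 : Integrable k := h1.comp_smul hpi.ne'
  have k2 : MemLp k 2 := MemLp.comp_smul_vec h2 hpi
  have e1 : 𝓕⁻ k = fun y => (1 / (2 * Real.pi) ^ m : ℝ) •
      ∫ ξ : Vec m, Complex.exp (Complex.I * (inner ℝ y ξ : ℝ)) • c ξ := by
    funext y
    have hs := Measure.integral_comp_smul_of_nonneg (volume : Measure (Vec m))
      (fun ξ => Complex.exp (Complex.I * (inner ℝ y ξ : ℝ)) • c ξ) (2 * Real.pi) (hR := hpi.le)
    rw [finrank_euclideanSpace_fin] at hs
    rw [one_div, ← hs, Real.fourierInv_eq']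
    refine integral_congr_ae (ae_of_all _ fun η => ?_)
    simp only [hk, inner_smul_right, real_inner_comm η y]
    congr 2
    push_cast
    ring
  have e2 := fourierInv_toLp_ae_eq k1 k2
  rw [← e1]
  have e3 : MemLp (𝓕⁻ k) 2 := (Lp.memLp _).ae_eq e2
  refine ⟨e3, ?_⟩
  have e4 : e3.toLp (𝓕⁻ k) = 𝓕⁻ (k2.toLp k) := Lp.ext (e3.coeFn_toLp.trans e2.symm)
  rw [e4, fourier_fourierInv_eq]
  have hq := Measure.quasiMeasurePreserving_smul (volume : Measure (Vec m))
    (r := (2 * Real.pi)⁻¹) (by positivity)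
  filter_upwards [hq.ae k2.coeFn_toLp] with ξ hξ
  rw [hξ, hk]
  simp only
  rw [smul_smul, mul_inv_cancel₀ hpi.ne', one_smul]

/-! ### Exponentially decaying functions and monogenic exponential integrals -/

/-- Comparison with the integrable `(1 + |ξ|)^{-(m+1)}`, using `t^n/n! ≤ e^t` at `t = δ(1 + |ξ|)`,
`n = m + 1`. -/
lemma integrable_exp_neg_mul_norm {δ : ℝ} (hδ : 0 < δ) :
    Integrable fun ξ : Vec m => Real.exp (-(δ * ‖ξ‖)) := by
  have h := integrable_one_add_norm (E := Vec m) (μ := volume) (r := ((m + 1 : ℕ) : ℝ)) (by simp)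
  refine (h.const_mul (((m + 1).factorial : ℝ) / δ ^ (m + 1) * Real.exp δ)).mono'
    (by fun_prop) (ae_of_all _ fun ξ => ?_)
  have h1 := Real.pow_div_factorial_le_exp (δ * (1 + ‖ξ‖)) (by positivity) (m + 1)
  rw [Real.norm_of_nonneg (Real.exp_pos _).le, Real.rpow_neg (by positivity), Real.rpow_natCast,
    Real.exp_neg, ← one_div, ← div_eq_mul_inv, div_le_div_iff₀ (by positivity) (by positivity)]
  rw [mul_pow, mul_add, mul_one, Real.exp_add, div_le_iff₀ (by positivity)] at h1
  have h2 : ((m + 1).factorial : ℝ) / δ ^ (m + 1) * Real.exp δ * Real.exp (δ * ‖ξ‖) =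
    (Real.exp δ * Real.exp (δ * ‖ξ‖) * (m + 1).factorial) / δ ^ (m + 1) := by ring
  rw [h2, one_mul, le_div_iff₀ (by positivity), mul_comm]
  exact h1

lemma memLp_exp_neg_mul_norm {δ : ℝ} (hδ : 0 < δ) :
    MemLp (fun ξ : Vec m => Real.exp (-(δ * ‖ξ‖))) 2 := by
  rw [memLp_two_iff_integrable_sq (by fun_prop)]
  refine (integrable_exp_neg_mul_norm (m := m) (mul_pos two_pos hδ)).congr
    (ae_of_all _ fun ξ => ?_)
  simp only
  rw [sq, ← Real.exp_add]
  congr 1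
  ring

/-- `e^{b|ξ|} c(ξ)` is square integrable for all `b < a`. -/
def ExpDecay (a : ℝ) (c : Vec m → Cl m) : Prop :=
  AEStronglyMeasurable c ∧ ∀ b < a, MemLp (fun ξ => Real.exp (b * ‖ξ‖) • c ξ) 2

lemma measurable_exp_mul_norm (b : ℝ) : Measurable fun ξ : Vec m => Real.exp (b * ‖ξ‖) := by
  fun_prop

lemma exp_smul_eq (b b' : ℝ) (ξ : Vec m) (x : Cl m) :
    Real.exp (b * ‖ξ‖) • x = Real.exp (-((b' - b) * ‖ξ‖)) • Real.exp (b' * ‖ξ‖) • x := by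
  rw [smul_smul, ← Real.exp_add]
  congr 2
  ring

/-- The room between `b` and some `b' < a` leaves a factor `e^{-(b'-b)|ξ|}` in `L²`, and
Cauchy–Schwarz applies. -/
lemma ExpDecay.integrable {a : ℝ} {c : Vec m → Cl m} (hc : ExpDecay a c) {b : ℝ} (hb : b < a) :
    Integrable fun ξ => Real.exp (b * ‖ξ‖) • c ξ := by
  obtain ⟨b', h1, h2⟩ := exists_between hb
  simp_rw [exp_smul_eq b b']
  rw [← memLp_one_iff_integrable]
  exact (hc.2 b' h2).smul (memLp_exp_neg_mul_norm (sub_pos.2 h1))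

lemma ExpDecay.integrable_norm {a : ℝ} {c : Vec m → Cl m} (hc : ExpDecay a c) {b : ℝ}
    (hb : b < a) : Integrable fun ξ => Real.exp (b * ‖ξ‖) * ‖c ξ‖ := by
  refine (hc.integrable hb).norm.congr (ae_of_all _ fun ξ => ?_)
  simp [norm_smul]

/-- `s ≤ e^s` at `s = (b' - b)|ξ|`. A factor `|ξ|`, whether from differentiation or from a Bergman
weight, is paid for by a small loss in the exponential rate. -/
lemma norm_mul_exp_le {b b' : ℝ} (h : b < b') (ξ : Vec m) :
    ‖ξ‖ * Real.exp (b * ‖ξ‖) ≤ (b' - b)⁻¹ * Real.exp (b' * ‖ξ‖) := by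
  have h0 : 0 < b' - b := sub_pos.2 h
  have h1 : b' * ‖ξ‖ = (b' - b) * ‖ξ‖ + b * ‖ξ‖ := by ring
  rw [h1, Real.exp_add, ← mul_assoc]
  gcongr
  rw [inv_mul_eq_div, le_div_iff₀ h0, mul_comm]
  have := Real.add_one_le_exp ((b' - b) * ‖ξ‖)
  linarith

lemma ExpDecay.of_norm_le {a : ℝ} {c c' : Vec m → Cl m} (hc : ExpDecay a c)
    (hm : AEStronglyMeasurable c') (C : ℝ) (h : ∀ ξ, ‖c' ξ‖ ≤ C * ‖c ξ‖) : ExpDecay a c' := by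
  refine ⟨hm, fun b hb => ?_⟩
  refine MemLp.of_le_mul (c := C) (hc.2 b hb)
    ((measurable_exp_mul_norm b).aestronglyMeasurable.smul hm) (ae_of_all _ fun ξ => ?_)
  rw [norm_smul, norm_smul, mul_left_comm]
  gcongr
  exact h ξ

lemma ExpDecay.norm_smul {a : ℝ} {c : Vec m → Cl m} (hc : ExpDecay a c) :
    ExpDecay a (fun ξ => ‖ξ‖ • c ξ) := by
  have hm : AEStronglyMeasurable (fun ξ => ‖ξ‖ • c ξ) :=
    measurable_norm.aestronglyMeasurable.smul hc.1
  refine ⟨hm, fun b hb => ?_⟩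
  obtain ⟨b', h1, h2⟩ := exists_between hb
  refine MemLp.of_le_mul (c := (b' - b)⁻¹) (hc.2 b' h2)
    ((measurable_exp_mul_norm b).aestronglyMeasurable.smul hm) (ae_of_all _ fun ξ => ?_)
  rw [_root_.norm_smul, _root_.norm_smul, _root_.norm_smul, norm_norm,
    Real.norm_of_nonneg (Real.exp_pos _).le,
    Real.norm_of_nonneg (Real.exp_pos _).le, ← mul_assoc, ← mul_assoc, mul_comm (Real.exp _)]
  exact mul_le_mul_of_nonneg_right (norm_mul_exp_le h1 ξ) (norm_nonneg _)

lemma ExpDecay.real_smul {a : ℝ} {c : Vec m → Cl m} (hc : ExpDecay a c) (r : ℝ) :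
    ExpDecay a (fun ξ => r • c ξ) :=
  hc.of_norm_le (hc.1.const_smul r) |r| fun ξ => by rw [_root_.norm_smul, Real.norm_eq_abs]

lemma aestronglyMeasurable_chi_mul {c : Vec m → Cl m} (hc : AEStronglyMeasurable c) (ε : ℝ) :
    AEStronglyMeasurable (fun ξ => chi ε ξ * c ξ) :=
  (measurable_chi ε).aestronglyMeasurable.mul hc

lemma ExpDecay.chi_mul {a : ℝ} {c : Vec m → Cl m} (hc : ExpDecay a c) {ε : ℝ}
    (hε : ε = 1 ∨ ε = -1) : ExpDecay a (fun ξ => chi ε ξ * c ξ) :=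
  hc.of_norm_le (aestronglyMeasurable_chi_mul hc.1 ε) (chiBound m)
    fun ξ => norm_chi_mul_le hε ξ (c ξ)

/-! ### Superpositions of monogenic exponentials: differentiation and slices -/

/-- The exponent of the monogenic exponentials, as a linear functional. -/
noncomputable def expForm (ε : ℝ) (ξ : Vec m) : ParaVec m →L[ℝ] ℂ :=
  Complex.I • (Complex.ofRealCLM.comp ((innerSL ℝ ξ).comp (ContinuousLinearMap.snd ℝ ℝ (Vec m)))) -
    ((ε * ‖ξ‖ : ℝ) : ℂ) • (Complex.ofRealCLM.comp (ContinuousLinearMap.fst ℝ ℝ (Vec m)))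

lemma expForm_apply (ε : ℝ) (ξ : Vec m) (x : ParaVec m) :
    expForm ε ξ x = Complex.I * (inner ℝ x.2 ξ : ℝ) - ((ε * x.1 * ‖ξ‖ : ℝ) : ℂ) := by
  simp [expForm, real_inner_comm]
  ring

lemma norm_expForm_le {ε : ℝ} (hε : ε = 1 ∨ ε = -1) (ξ : Vec m) : ‖expForm ε ξ‖ ≤ 2 * ‖ξ‖ := by
  refine ContinuousLinearMap.opNorm_le_bound _ (by positivity) fun x => ?_
  rw [expForm_apply]
  have he : |ε| = 1 := by rcases hε with h | h <;> simp [h]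
  have h1 : ‖Complex.I * ((inner ℝ x.2 ξ : ℝ) : ℂ)‖ ≤ ‖x‖ * ‖ξ‖ := by
    rw [norm_mul, Complex.norm_I, one_mul, Complex.norm_real]
    refine (norm_inner_le_norm _ _).trans ?_
    gcongr
    exact norm_snd_le x
  have h2 : ‖((ε * x.1 * ‖ξ‖ : ℝ) : ℂ)‖ ≤ ‖x‖ * ‖ξ‖ := by
    rw [Complex.norm_real, norm_mul, norm_mul, Real.norm_eq_abs, he, one_mul, norm_norm]
    gcongr
    exact norm_fst_le x
  refine (norm_sub_le _ _).trans ?_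
  linarith

lemma monExp_mul (ε : ℝ) (x : ParaVec m) (ξ : Vec m) (c : Cl m) :
    monExp ε x ξ * c = Complex.exp (expForm ε ξ x) • (chi ε ξ * c) := by
  rw [monExp, smul_mul_assoc, expForm_apply, sub_eq_add_neg, Complex.exp_add]
  push_cast
  rfl

lemma norm_exp_expForm (ε : ℝ) (x : ParaVec m) (ξ : Vec m) :
    ‖Complex.exp (expForm ε ξ x)‖ = Real.exp (-(ε * x.1) * ‖ξ‖) := by
  rw [Complex.norm_exp, expForm_apply]
  simp

lemma measurable_exp_expForm (ε : ℝ) (x : ParaVec m) :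
    Measurable fun ξ : Vec m => Complex.exp (expForm ε ξ x) := by
  simp only [expForm_apply]
  fun_prop

/-- The superposition of monogenic exponentials with density `c`. -/
noncomputable def monInt (ε : ℝ) (c : Vec m → Cl m) (x : ParaVec m) : Cl m :=
  (1 / (2 * Real.pi) ^ m : ℝ) • ∫ ξ : Vec m, monExp ε x ξ * c ξ

lemma isOpen_halfSpace (ε a : ℝ) : IsOpen (halfSpace m ε a) := by
  unfold halfSpace
  exact isOpen_lt (by fun_prop) (by fun_prop)

lemma integrable_monExp_mul {ε a : ℝ} (hε : ε = 1 ∨ ε = -1) {c : Vec m → Cl m}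
    (hc : ExpDecay a c) {x : ParaVec m} (hx : x ∈ halfSpace m ε a) :
    Integrable fun ξ => monExp ε x ξ * c ξ := by
  have hx' : -(ε * x.1) < a := by
    have : -a < ε * x.1 := hx
    linarith
  refine ((hc.chi_mul hε).integrable hx').norm.mono' ?_ (ae_of_all _ fun ξ => ?_)
  · simp only [monExp_mul]
    exact (measurable_exp_expForm ε x).aestronglyMeasurable.smul
      (aestronglyMeasurable_chi_mul hc.1 ε)
  · rw [monExp_mul, norm_smul, norm_exp_expForm, norm_smul, Real.norm_of_nonneg (Real.exp_pos _).le]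

/-- The real linear map `z ↦ z • v` on `ℂ`, depending linearly and continuously on `v`. -/
noncomputable def smulFlip : Cl m →L[ℝ] ℂ →L[ℝ] Cl m :=
  (ContinuousLinearMap.lsmul ℝ ℂ).flip

@[simp] lemma smulFlip_apply (v : Cl m) (z : ℂ) : smulFlip v z = z • v := rfl

/-- The derivative of `x ↦ monExp ε x ξ * c`. -/
noncomputable def monExpDeriv (ε : ℝ) (c : Vec m → Cl m) (x : ParaVec m) (ξ : Vec m) :
    ParaVec m →L[ℝ] Cl m :=
  (smulFlip (chi ε ξ * c ξ)).comp (Complex.exp (expForm ε ξ x) • expForm ε ξ)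

lemma monExpDeriv_apply (ε : ℝ) (c : Vec m → Cl m) (x v : ParaVec m) (ξ : Vec m) :
    monExpDeriv ε c x ξ v = expForm ε ξ v • (monExp ε x ξ * c ξ) := by
  rw [monExp_mul, monExpDeriv, ContinuousLinearMap.comp_apply, smulFlip_apply, smul_smul, mul_comm]
  rfl

lemma hasFDerivAt_monExp_mul (ε : ℝ) (c : Vec m → Cl m) (x : ParaVec m) (ξ : Vec m) :
    HasFDerivAt (fun x => monExp ε x ξ * c ξ) (monExpDeriv ε c x ξ) x := by
  simp only [monExp_mul]
  exact (smulFlip (chi ε ξ * c ξ)).hasFDerivAt.comp x (expForm ε ξ).hasFDerivAt.cexp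

lemma continuous_expForm (ε : ℝ) : Continuous fun ξ : Vec m => expForm ε ξ := by
  have h1 : Continuous fun ξ : Vec m => Complex.ofRealCLM.comp
      ((innerSL ℝ ξ).comp (ContinuousLinearMap.snd ℝ ℝ (Vec m))) :=
    continuous_const.clm_comp ((innerSL ℝ (E := Vec m)).continuous.clm_comp continuous_const)
  have h2 : Continuous fun ξ : Vec m => ((ε * ‖ξ‖ : ℝ) : ℂ) := by fun_prop
  exact (h1.const_smul Complex.I).sub (h2.smul continuous_const)

lemma aestronglyMeasurable_monExpDeriv {ε : ℝ} {c : Vec m → Cl m}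
    (hc : AEStronglyMeasurable c) (x : ParaVec m) :
    AEStronglyMeasurable (monExpDeriv ε c x) := by
  have h2 : AEStronglyMeasurable fun ξ : Vec m => Complex.exp (expForm ε ξ x) • expForm ε ξ :=
    (measurable_exp_expForm ε x).aestronglyMeasurable.smul
      (continuous_expForm ε).aestronglyMeasurable
  have h3 : AEStronglyMeasurable fun ξ : Vec m => smulFlip (chi ε ξ * c ξ) :=
    smulFlip.continuous.comp_aestronglyMeasurable (aestronglyMeasurable_chi_mul hc ε)
  have h4 : Continuous fun p : (ℂ →L[ℝ] Cl m) × (ParaVec m →L[ℝ] ℂ) => p.1.comp p.2 :=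
    continuous_fst.clm_comp continuous_snd
  exact h4.comp_aestronglyMeasurable (h3.prodMk h2)

lemma norm_monExpDeriv_le {ε : ℝ} (hε : ε = 1 ∨ ε = -1) (c : Vec m → Cl m) {x : ParaVec m}
    {b : ℝ} (hx : -b ≤ ε * x.1) (ξ : Vec m) :
    ‖monExpDeriv ε c x ξ‖ ≤ 2 * (Real.exp (b * ‖ξ‖) * ‖‖ξ‖ • (chi ε ξ * c ξ)‖) := by
  refine ContinuousLinearMap.opNorm_le_bound _ (by positivity) fun v => ?_
  have h1 : Real.exp (-(ε * x.1) * ‖ξ‖) ≤ Real.exp (b * ‖ξ‖) := by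
    gcongr
    linarith
  have h2 := (expForm ε ξ).le_of_opNorm_le (norm_expForm_le hε ξ) v
  rw [monExpDeriv_apply, monExp_mul, norm_smul, norm_smul, norm_exp_expForm,
    norm_smul, norm_norm]
  calc _ ≤ (2 * ‖ξ‖ * ‖v‖) * (Real.exp (b * ‖ξ‖) * ‖chi ε ξ * c ξ‖) := by
        gcongr
    _ = _ := by ring

lemma exists_nhds_halfSpace {ε a : ℝ} {x : ParaVec m} (hx : x ∈ halfSpace m ε a) :
    ∃ b < a, ∃ s ∈ 𝓝 x, ∀ y ∈ s, -b ≤ ε * y.1 := by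
  have hx' : -a < ε * x.1 := hx
  obtain ⟨b, h1, h2⟩ := exists_between hx'
  refine ⟨-b, by linarith, {y | b < ε * y.1}, ?_, fun y hy => ?_⟩
  · exact (isOpen_lt (by fun_prop) (by fun_prop)).mem_nhds h2
  · rw [neg_neg]
    exact le_of_lt hy

/-- Differentiation under the integral: near `x` one has `-ε y₀ ≤ b` with a fixed `b < a`, so a
constant times `e^{b|ξ|} |ξ| |χ c|` dominates all derivatives. -/
lemma hasFDerivAt_monInt {ε a : ℝ} (hε : ε = 1 ∨ ε = -1) {c : Vec m → Cl m}
    (hc : ExpDecay a c) {x : ParaVec m} (hx : x ∈ halfSpace m ε a) :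
    HasFDerivAt (monInt ε c)
      ((1 / (2 * Real.pi) ^ m : ℝ) • ∫ ξ, monExpDeriv ε c x ξ) x := by
  obtain ⟨b, hb, s, hs, hbs⟩ := exists_nhds_halfSpace hx
  refine HasFDerivAt.fun_const_smul (R := ℝ) (hasFDerivAt_integral_of_dominated_of_fderiv_le (𝕜 := ℝ)
    (F' := fun x ξ => monExpDeriv ε c x ξ) hs ?_
    (integrable_monExp_mul hε hc hx) (aestronglyMeasurable_monExpDeriv hc.1 x)
    (ae_of_all _ fun ξ y hy => norm_monExpDeriv_le hε c (hbs y hy) ξ)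
    (((hc.chi_mul hε).norm_smul.integrable_norm hb).const_mul 2)
    (ae_of_all _ fun ξ y _ => hasFDerivAt_monExp_mul ε c y ξ)) _
  filter_upwards [(isOpen_halfSpace ε a).mem_nhds hx] with y hy
  exact (integrable_monExp_mul hε hc hy).1

lemma integrable_monExpDeriv {ε a : ℝ} (hε : ε = 1 ∨ ε = -1) {c : Vec m → Cl m}
    (hc : ExpDecay a c) {x : ParaVec m} (hx : x ∈ halfSpace m ε a) :
    Integrable (monExpDeriv ε c x) := by
  obtain ⟨b, hb, s, hs, hbs⟩ := exists_nhds_halfSpace hx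
  exact (((hc.chi_mul hε).norm_smul.integrable_norm hb).const_mul 2).mono'
    (aestronglyMeasurable_monExpDeriv hc.1 x)
    (ae_of_all _ fun ξ => norm_monExpDeriv_le hε c (hbs x (mem_of_mem_nhds hs)) ξ)

lemma fderiv_monInt_apply {ε a : ℝ} (hε : ε = 1 ∨ ε = -1) {c : Vec m → Cl m}
    (hc : ExpDecay a c) {x : ParaVec m} (hx : x ∈ halfSpace m ε a) (v : ParaVec m) :
    fderiv ℝ (monInt ε c) x v =
      (1 / (2 * Real.pi) ^ m : ℝ) • ∫ ξ, expForm ε ξ v • (monExp ε x ξ * c ξ) := by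
  rw [(hasFDerivAt_monInt hε hc hx).fderiv, _root_.smul_apply,
    ContinuousLinearMap.integral_apply (integrable_monExpDeriv hε hc hx)]
  simp only [monExpDeriv_apply]

lemma contDiffOn_monInt {ε a : ℝ} (hε : ε = 1 ∨ ε = -1) {c : Vec m → Cl m}
    (hc : ExpDecay a c) : ContDiffOn ℝ 1 (monInt ε c) (halfSpace m ε a) := by
  intro x hx
  refine ContDiffAt.contDiffWithinAt (contDiffAt_one_iff.2 ⟨_, _,
    (isOpen_halfSpace ε a).mem_nhds hx, fun y hy => ContinuousAt.continuousWithinAt ?_,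
    fun y hy => hasFDerivAt_monInt hε hc hy⟩)
  obtain ⟨b, hb, s, hs, hbs⟩ := exists_nhds_halfSpace hy
  refine ContinuousAt.const_smul (M := ℝ) (continuousAt_of_dominated
    (Eventually.of_forall fun y => aestronglyMeasurable_monExpDeriv hc.1 y) ?_
    (((hc.chi_mul hε).norm_smul.integrable_norm hb).const_mul 2) ?_) _
  · filter_upwards [hs] with z hz
    exact ae_of_all _ fun ξ => norm_monExpDeriv_le hε c (hbs z hz) ξ
  · refine ae_of_all _ fun ξ => Continuous.continuousAt ?_
    have h1 : Continuous fun z : ParaVec m => Complex.exp (expForm ε ξ z) • expForm ε ξ :=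
      (Complex.continuous_exp.comp (expForm ε ξ).continuous).smul continuous_const
    exact (continuous_const (y := smulFlip (chi ε ξ * c ξ))).clm_comp h1

/-- Under the integral the Dirac operator becomes left multiplication by `-ε|ξ| + iξ`, which
annihilates `χ_ε c` by `I_vec_mul_chi`. -/
lemma isLeftMonogenic_monInt {ε a : ℝ} (hε : ε = 1 ∨ ε = -1) {c : Vec m → Cl m}
    (hc : ExpDecay a c) : IsLeftMonogenic (monInt ε c) (halfSpace m ε a) := by
  refine ⟨contDiffOn_monInt hε hc, fun x hx => ?_⟩
  have hi : ∀ v, Integrable fun ξ => expForm ε ξ v • (monExp ε x ξ * c ξ) := fun v => by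
    simpa only [monExpDeriv_apply] using
      (integrable_monExpDeriv hε hc hx).apply_continuousLinearMap v
  have hk : ∀ k : Fin m, gen k * ∫ ξ, expForm ε ξ (0, EuclideanSpace.single k 1) •
      (monExp ε x ξ * c ξ) = ∫ ξ, gen k * (expForm ε ξ (0, EuclideanSpace.single k 1) •
      (monExp ε x ξ * c ξ)) := fun k => ((mulR m (gen k)).integral_comp_comm (hi _)).symm
  have hi' : ∀ k : Fin m, Integrable fun ξ => gen k *
      (expForm ε ξ (0, EuclideanSpace.single k 1) • (monExp ε x ξ * c ξ)) :=
    fun k => (mulR m (gen k)).integrable_comp (hi _)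
  unfold dirac
  simp only [fderiv_monInt_apply hε hc hx, mul_real_smul, ← Finset.smul_sum, hk]
  rw [← integral_finsetSum _ fun k _ => hi' k, ← smul_add,
    ← integral_add (hi _) (integrable_finsetSum _ fun k _ => hi' k)]
  convert smul_zero _
  refine integral_eq_zero_of_ae (ae_of_all _ fun ξ => ?_)
  simp only [Pi.zero_apply]
  have h1 : expForm ε ξ (1, 0) = -((ε * ‖ξ‖ : ℝ) : ℂ) := by
    rw [expForm_apply]
    simp
  have h2 : ∀ k, expForm ε ξ (0, EuclideanSpace.single k 1) = Complex.I * (ξ k : ℂ) := fun k => by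
    rw [expForm_apply]
    simp [EuclideanSpace.inner_single_left]
  have h3 : ∑ k, gen k * (expForm ε ξ (0, EuclideanSpace.single k 1) • (monExp ε x ξ * c ξ)) =
      (Complex.I • vec ξ) * (monExp ε x ξ * c ξ) := by
    rw [vec, Finset.smul_sum, Finset.sum_mul]
    refine Finset.sum_congr rfl fun k _ => ?_
    rw [h2, mul_smul_comm, smul_mul_assoc, smul_mul_assoc, smul_smul]
  rw [h1, h3, monExp_mul, mul_smul_comm, ← mul_assoc, I_vec_mul_chi hε, smul_mul_assoc,
    smul_comm, ← smul_add, ← add_smul]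
  simp

/-- The Fourier transform of a slice of `monInt`. -/
lemma isFourierTransformL2_monInt {ε a : ℝ} (hε : ε = 1 ∨ ε = -1) {c : Vec m → Cl m}
    (hc : ExpDecay a c) {t : ℝ} (ht : -a < ε * t) :
    IsFourierTransformL2 (fun y => monInt ε c (t, y))
      (fun ξ => Real.exp (-(ε * t) * ‖ξ‖) • (chi ε ξ * c ξ)) := by
  have ht' : -(ε * t) < a := by linarith
  have := isFourierTransformL2_of_integrable ((hc.chi_mul hε).integrable ht')
    ((hc.chi_mul hε).2 _ ht')
  convert this using 2 with y
  rw [monInt]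
  congr 2
  funext ξ
  rw [monExp_mul, expForm_apply, sub_eq_add_neg, Complex.exp_add, real_smul_eq, smul_smul]
  congr 2
  push_cast
  ring_nf

lemma lintegral_monInt {ε a : ℝ} (hε : ε = 1 ∨ ε = -1) {c : Vec m → Cl m}
    (hc : ExpDecay a c) {t : ℝ} (ht : -a < ε * t) :
    ∫⁻ y, ‖monInt ε c (t, y)‖ₑ ^ 2 = ENNReal.ofReal (((2 * Real.pi) ^ m)⁻¹) *
      ∫⁻ ξ, ENNReal.ofReal (Real.exp (-(2 * (ε * t)) * ‖ξ‖)) * ‖chi ε ξ * c ξ‖ₑ ^ 2 := by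
  rw [(isFourierTransformL2_monInt hε hc ht).lintegral_eq]
  congr 1
  refine lintegral_congr fun ξ => ?_
  rw [enorm_smul, mul_pow, Real.enorm_of_nonneg (Real.exp_pos _).le,
    ← ENNReal.ofReal_pow (Real.exp_pos _).le, ← Real.exp_nat_mul]
  congr 3
  push_cast
  ring

/-! ### Cauchy's theorem for a pair of monogenic functions on a slab -/

lemma integrable_prod_of_continuousOn {E : Type*} [NormedAddCommGroup E] {s t : ℝ}
    {K : Set (Vec m)} (hK : IsCompact K) {F : ℝ × Vec m → E}
    (hF : ContinuousOn F (Set.Icc s t ×ˢ Set.univ)) (h0 : ∀ x, x.2 ∉ K → F x = 0) :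
    Integrable F ((volume.restrict (Set.Ioc s t)).prod volume) := by
  have h1 : IntegrableOn F (Set.Icc s t ×ˢ K) (volume.prod volume) :=
    (hF.mono (Set.prod_mono_right (Set.subset_univ _))).integrableOn_compact
      (isCompact_Icc.prod hK)
  have h2 : IntegrableOn F (Set.Ioc s t ×ˢ K) (volume.prod volume) :=
    h1.mono_set (Set.prod_mono_left Set.Ioc_subset_Icc_self)
  have h3 : IntegrableOn F (Set.Ioc s t ×ˢ Set.univ) (volume.prod volume) :=
    h2.of_forall_sdiff_eq_zero (measurableSet_Ioc.prod MeasurableSet.univ) fun x hx =>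
      h0 x fun hxK => hx.2 ⟨hx.1.1, hxK⟩
  rwa [IntegrableOn, ← Measure.prod_restrict, Measure.restrict_univ] at h3

lemma hasFDerivAt_cl_mul {E : Type*} [NormedAddCommGroup E] [NormedSpace ℝ E] {H f : E → Cl m}
    {x : E} (hH : DifferentiableAt ℝ H x) (hf : DifferentiableAt ℝ f x) :
    HasFDerivAt (fun x => H x * f x)
      ((mulR m).precompR E (H x) (fderiv ℝ f x) + (mulR m).precompL E (fderiv ℝ H x) (f x)) x :=
  (mulR m).hasFDerivAt_of_bilinear hH.hasFDerivAt hf.hasFDerivAt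

lemma hasFDerivAt_slice (t : ℝ) (y : Vec m) :
    HasFDerivAt (fun y : Vec m => ((t, y) : ParaVec m)) (ContinuousLinearMap.inr ℝ ℝ (Vec m)) y :=
  hasFDerivAt_prodMk_right t y

/-- Integration by parts on a slice. -/
lemma integral_slice_by_parts {H f : ParaVec m → Cl m} {t : ℝ}
    (hH : ∀ y, ContDiffAt ℝ 1 H (t, y)) (hf : ∀ y, ContDiffAt ℝ 1 f (t, y))
    {θ : Vec m → ℝ} (hθ : ContDiff ℝ 1 θ) (hc : HasCompactSupport θ) (v : Vec m) (e : Cl m) :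
    ∫ y, θ y • (fderiv ℝ H (t, y) (0, v) * e * f (t, y) + H (t, y) * (e * fderiv ℝ f (t, y) (0, v)))
      = -∫ y, fderiv ℝ θ y v • (H (t, y) * e * f (t, y)) := by
  set g : Vec m → Cl m := fun y => H (t, y) * (e * f (t, y)) with hg
  have hgd : ∀ y, HasFDerivAt g ((((mulR m).precompR (ParaVec m) (H (t, y))
      ((mulR m e).comp (fderiv ℝ f (t, y))) + (mulR m).precompL (ParaVec m)
      (fderiv ℝ H (t, y)) (e * f (t, y)))).comp (ContinuousLinearMap.inr ℝ ℝ (Vec m))) y := by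
    intro y
    have h1 : HasFDerivAt (fun x => H x * (e * f x)) _ (t, y) :=
      (mulR m).hasFDerivAt_of_bilinear ((hH y).differentiableAt one_ne_zero).hasFDerivAt
        ((mulR m e).hasFDerivAt.comp (t, y) ((hf y).differentiableAt one_ne_zero).hasFDerivAt)
    exact h1.comp y (hasFDerivAt_slice t y)
  have hgv : ∀ y, fderiv ℝ g y v = fderiv ℝ H (t, y) (0, v) * e * f (t, y) +
      H (t, y) * (e * fderiv ℝ f (t, y) (0, v)) := by
    intro y
    rw [(hgd y).fderiv, add_comm, mul_assoc]
    rfl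
  have hsl : ContDiff ℝ 1 fun y : Vec m => ((t, y) : ParaVec m) := contDiff_prodMk_right t
  have hg1 : ContDiff ℝ 1 g := by
    have h1 : ContDiff ℝ 1 fun y => H (t, y) := contDiff_iff_contDiffAt.2 fun y =>
      (hH y).comp y hsl.contDiffAt
    have h2 : ContDiff ℝ 1 fun y => f (t, y) := contDiff_iff_contDiffAt.2 fun y =>
      (hf y).comp y hsl.contDiffAt
    exact (mulR m).isBoundedBilinearMap.contDiff.comp (h1.prodMk ((mulR m e).contDiff.comp h2))
  have hθ' : Continuous fun y => fderiv ℝ θ y v := (hθ.continuous_fderiv one_ne_zero).clm_apply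
    continuous_const
  have hg' : Continuous fun y => fderiv ℝ g y v := (hg1.continuous_fderiv one_ne_zero).clm_apply
    continuous_const
  have hc' : HasCompactSupport fun y => fderiv ℝ θ y v := hc.fderiv_apply ℝ v
  have := integral_smul_fderiv_eq_neg_fderiv_smul_of_integrable (μ := volume) (𝕜 := ℝ)
    (f := θ) (g := g) (v := v)
    ((hθ'.smul hg1.continuous).integrable_of_hasCompactSupport hc'.smul_right)
    ((hθ.continuous.smul hg').integrable_of_hasCompactSupport hc.smul_right)
    ((hθ.continuous.smul hg1.continuous).integrable_of_hasCompactSupport hc.smul_right)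
    (fun x _ => hθ.differentiable one_ne_zero x) (fun x _ => hg1.differentiable one_ne_zero x)
  simp only [hgv] at this
  simpa only [hg, mul_assoc] using this

/-- `H` is right-monogenic. -/
def IsRightMonogenic (H : ParaVec m → Cl m) : Prop :=
  ContDiff ℝ 1 H ∧ ∀ x, fderiv ℝ H x (1, 0) +
    ∑ k, fderiv ℝ H x (0, EuclideanSpace.single k 1) * gen k = 0

/-- The density of the flux through the lateral boundary created by the cutoff `θ`. -/
noncomputable def lateralFlux (θ : Vec m → ℝ) (H f : ParaVec m → Cl m) (t : ℝ) (y : Vec m) : Cl m :=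
  ∑ k, fderiv ℝ θ y (EuclideanSpace.single k 1) • (H (t, y) * gen k * f (t, y))

/-- The two monogenic equations trade the `x₀`-derivatives of `H f` for `-∑ ∂_k(H e_k f)`, an exact
divergence in the slice; integration by parts then puts all derivatives on the cutoff. -/
lemma integral_slice_deriv {ε a : ℝ} {H f : ParaVec m → Cl m} (hH : IsRightMonogenic H)
    (hf : IsLeftMonogenic f (halfSpace m ε a)) {t : ℝ} (ht : -a < ε * t)
    {θ : Vec m → ℝ} (hθ : ContDiff ℝ 1 θ) (hc : HasCompactSupport θ) :
    ∫ y, θ y • (fderiv ℝ H (t, y) (1, 0) * f (t, y) + H (t, y) * fderiv ℝ f (t, y) (1, 0)) =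
      ∫ y, lateralFlux θ H f t y := by
  have hfa : ∀ y, ContDiffAt ℝ 1 f (t, y) := fun y =>
    hf.1.contDiffAt ((isOpen_halfSpace ε a).mem_nhds ht)
  have hHa : ∀ y, ContDiffAt ℝ 1 H (t, y) := fun y => hH.1.contDiffAt
  have hsl : Continuous fun y : Vec m => ((t, y) : ParaVec m) := by fun_prop
  have hfc : Continuous fun y => f (t, y) := continuous_iff_continuousAt.2 fun y =>
    ContinuousAt.comp (hfa y).continuousAt hsl.continuousAt
  have hHc : Continuous fun y => H (t, y) := hH.1.continuous.comp hsl
  have hf' : ∀ v, Continuous fun y => fderiv ℝ f (t, y) v := fun v =>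
    continuous_iff_continuousAt.2 fun y => ContinuousAt.clm_apply
      (ContinuousAt.comp (f := fun y : Vec m => ((t, y) : ParaVec m))
        ((hfa y).continuousAt_fderiv one_ne_zero) hsl.continuousAt)
      continuousAt_const
  have hH' : ∀ v, Continuous fun y => fderiv ℝ H (t, y) v := fun v =>
    ((hH.1.continuous_fderiv one_ne_zero).comp hsl).clm_apply continuous_const
  have hθ' : ∀ v, Continuous fun y => fderiv ℝ θ y v := fun v =>
    (hθ.continuous_fderiv one_ne_zero).clm_apply continuous_const
  have key : ∀ y, θ y • (fderiv ℝ H (t, y) (1, 0) * f (t, y) +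
      H (t, y) * fderiv ℝ f (t, y) (1, 0)) = -∑ k, θ y •
      (fderiv ℝ H (t, y) (0, EuclideanSpace.single k 1) * gen k * f (t, y) +
        H (t, y) * (gen k * fderiv ℝ f (t, y) (0, EuclideanSpace.single k 1))) := by
    intro y
    have e1 := eq_neg_of_add_eq_zero_left (hH.2 (t, y))
    have e2 := eq_neg_of_add_eq_zero_left (hf.2 (t, y) ht)
    rw [e1, e2, ← Finset.smul_sum, ← smul_neg, Finset.sum_add_distrib, ← Finset.mul_sum,
      ← Finset.sum_mul, neg_add, neg_mul, mul_neg]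
  simp only [key, lateralFlux]
  rw [integral_neg, integral_finsetSum, integral_finsetSum, ← Finset.sum_neg_distrib]
  · refine Finset.sum_congr rfl fun k _ => ?_
    rw [integral_slice_by_parts hHa hfa hθ hc, neg_neg]
  · exact fun k _ => ((hθ' _).smul ((hHc.mul continuous_const).mul
      hfc)).integrable_of_hasCompactSupport (hc.fderiv_apply ℝ _).smul_right
  · exact fun k _ => (hθ.continuous.smul ((((hH' _).mul continuous_const).mul hfc).add
      (hHc.mul (continuous_const.mul (hf' _))))).integrable_of_hasCompactSupport hc.smul_right

/-- `integral_slice_deriv` integrated over the slab. The cutoff makes the integrand compactly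
supported, so Fubini and the fundamental theorem of calculus apply with no decay assumed on `H` or
`f`. -/
lemma integral_slice_sub {ε a : ℝ} {H f : ParaVec m → Cl m} (hH : IsRightMonogenic H)
    (hf : IsLeftMonogenic f (halfSpace m ε a)) {s t : ℝ} (hst : s ≤ t)
    (hI : ∀ τ ∈ Set.Icc s t, -a < ε * τ)
    {θ : Vec m → ℝ} (hθ : ContDiff ℝ 1 θ) (hc : HasCompactSupport θ) :
    (∫ y, θ y • (H (t, y) * f (t, y))) - ∫ y, θ y • (H (s, y) * f (s, y)) =
      ∫ τ in Set.Ioc s t, ∫ y, lateralFlux θ H f τ y := by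
  have hfa : ∀ τ ∈ Set.Icc s t, ∀ y, ContDiffAt ℝ 1 f (τ, y) := fun τ hτ y =>
    hf.1.contDiffAt ((isOpen_halfSpace ε a).mem_nhds (hI τ hτ))
  set W : ℝ × Vec m → Cl m := fun x =>
    fderiv ℝ H x (1, 0) * f x + H x * fderiv ℝ f x (1, 0) with hW
  have hWc : ContinuousOn W (Set.Icc s t ×ˢ Set.univ) := by
    intro x hx
    have h1 := hfa x.1 hx.1 x.2
    have h2 : ContinuousAt (fun x => fderiv ℝ f x (1, 0)) x :=
      (h1.continuousAt_fderiv one_ne_zero).clm_apply continuousAt_const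
    have h3 : Continuous fun x => fderiv ℝ H x (1, 0) :=
      (hH.1.continuous_fderiv one_ne_zero).clm_apply continuous_const
    exact ((h3.continuousAt.mul h1.continuousAt).add
      (hH.1.continuous.continuousAt.mul h2)).continuousWithinAt
  have hint : Integrable (fun x : ℝ × Vec m => θ x.2 • W x)
      ((volume.restrict (Set.Ioc s t)).prod volume) :=
    integrable_prod_of_continuousOn hc.isCompact
      (((hθ.continuous.comp continuous_snd).continuousOn).smul hWc) fun x hx => by
        rw [image_eq_zero_of_notMem_tsupport hx, zero_smul]
  have hder : ∀ y, ∫ τ in Set.Ioc s t, θ y • W (τ, y) =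
      θ y • (H (t, y) * f (t, y)) - θ y • (H (s, y) * f (s, y)) := by
    intro y
    rw [← intervalIntegral.integral_of_le hst]
    have hd : ∀ τ ∈ Set.uIcc s t, HasDerivAt (fun τ => θ y • (H (τ, y) * f (τ, y)))
        (θ y • W (τ, y)) τ := by
      intro τ hτ
      rw [Set.uIcc_of_le hst] at hτ
      have h1 := hasFDerivAt_cl_mul (hH.1.differentiable one_ne_zero (τ, y))
        ((hfa τ hτ y).differentiableAt one_ne_zero)
      have h2 : HasDerivAt (fun τ : ℝ => ((τ, y) : ParaVec m)) (1, 0) τ :=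
        (hasDerivAt_id τ).prodMk (hasDerivAt_const τ y)
      have h3 := (h1.comp_hasDerivAt τ h2).const_smul (θ y)
      convert! h3 using 1
      rw [hW]
      simp only [add_comm]
      rfl
    rw [intervalIntegral.integral_eq_sub_of_hasDerivAt hd]
    refine ContinuousOn.intervalIntegrable ?_
    rw [Set.uIcc_of_le hst]
    have hp : ContinuousOn (fun τ : ℝ => (τ, y)) (Set.Icc s t) := by fun_prop
    exact (hWc.comp hp fun τ hτ => ⟨hτ, trivial⟩).const_smul (θ y)
  have hsl : ∀ τ ∈ Set.Icc s t, Integrable fun y => θ y • (H (τ, y) * f (τ, y)) := by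
    intro τ hτ
    have hsl : Continuous fun y : Vec m => ((τ, y) : ParaVec m) := by fun_prop
    have hfc : Continuous fun y => f (τ, y) := continuous_iff_continuousAt.2 fun y =>
      ContinuousAt.comp (hfa τ hτ y).continuousAt hsl.continuousAt
    exact (hθ.continuous.smul ((hH.1.continuous.comp hsl).mul
      hfc)).integrable_of_hasCompactSupport hc.smul_right
  rw [← integral_sub (hsl t ⟨hst, le_rfl⟩) (hsl s ⟨le_rfl, hst⟩)]
  simp only [← hder]
  rw [← integral_integral_swap hint]
  refine setIntegral_congr_fun measurableSet_Ioc fun τ hτ => ?_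
  exact integral_slice_deriv hH hf (hI τ ⟨hτ.1.le, hτ.2⟩) hθ hc

/-! ### Removing the cutoff -/

/-- A sequence of cutoff functions on `ℝ^m` with gradients tending to zero uniformly. -/
lemma exists_cutoff (m : ℕ) : ∃ (θ : ℕ → Vec m → ℝ) (C : ℝ), 0 ≤ C ∧
    (∀ n, ContDiff ℝ 1 (θ n)) ∧ (∀ n, HasCompactSupport (θ n)) ∧
    (∀ n y, |θ n y| ≤ 1) ∧ (∀ y, ∀ᶠ n in atTop, θ n y = 1) ∧
    ∀ n y (v : Vec m), ‖v‖ = 1 → |fderiv ℝ (θ n) y v| ≤ C / (n + 1) := by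
  let b : ContDiffBump (0 : Vec m) := ⟨1, 2, one_pos, one_lt_two⟩
  have hb : ContDiff ℝ 1 b := b.contDiff
  obtain ⟨C, hC⟩ := ((b.hasCompactSupport.fderiv ℝ).exists_bound_of_continuous
    (hb.continuous_fderiv one_ne_zero))
  have hr : ∀ n : ℕ, ((n : ℝ) + 1)⁻¹ ≠ 0 := fun n => by positivity
  -- Dilates of one bump: stretching by `n + 1` divides the gradient by `n + 1`.
  refine ⟨fun n y => b (((n : ℝ) + 1)⁻¹ • y), C, (norm_nonneg _).trans (hC 0),
    fun n => hb.comp (contDiff_const_smul _),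
    fun n => b.hasCompactSupport.comp_homeomorph (Homeomorph.smulOfNeZero _ (hr n)),
    fun n y => ?_, fun y => ?_, fun n y v hv => ?_⟩
  · rw [abs_of_nonneg b.nonneg]
    exact b.le_one
  · obtain ⟨N, hN⟩ := exists_nat_ge ‖y‖
    filter_upwards [eventually_ge_atTop N] with n hn
    refine b.one_of_mem_closedBall ?_
    rw [mem_closedBall_zero_iff, norm_smul, norm_inv, Real.norm_of_nonneg (by positivity),
      inv_mul_le_iff₀ (by positivity)]
    have : (N : ℝ) ≤ n := by exact_mod_cast hn
    change ‖y‖ ≤ (n + 1) * 1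
    linarith
  · have h1 : HasFDerivAt (fun y => b (((n : ℝ) + 1)⁻¹ • y))
        ((fderiv ℝ b (((n : ℝ) + 1)⁻¹ • y)).comp (((n : ℝ) + 1)⁻¹ • ContinuousLinearMap.id ℝ _)) y :=
      (hb.differentiable one_ne_zero _).hasFDerivAt.comp y ((hasFDerivAt_id y).fun_const_smul _)
    rw [h1.fderiv, ContinuousLinearMap.comp_apply, _root_.smul_apply,
      ContinuousLinearMap.id_apply, map_smul, smul_eq_mul, abs_mul, abs_of_nonneg (by positivity),
      inv_mul_eq_div]
    gcongr
    have := (fderiv ℝ b (((n : ℝ) + 1)⁻¹ • y)).le_of_opNorm_le (hC _) v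
    rwa [hv, mul_one] at this

/-- The slice norm `∫ |f(t, y)|² dy`. -/
noncomputable def sliceNorm (f : ParaVec m → Cl m) (t : ℝ) : ℝ≥0∞ :=
  ∫⁻ y : Vec m, ‖f (t, y)‖ₑ ^ 2

/-- A constant for the estimate of the lateral flux. -/
noncomputable def fluxBound (m : ℕ) : ℝ := ∑ k : Fin m, ‖mulC m‖ * (‖mulC m‖ * ‖gen k‖)

lemma fluxBound_nonneg (m : ℕ) : 0 ≤ fluxBound m :=
  Finset.sum_nonneg fun _ _ => by positivity

/-- By `|u||v| ≤ |u|² + |v|²` the flux is bounded by slice norms of `H` and `f` times the size of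
the gradient of the cutoff, which tends to zero along the cutoff sequence. -/
lemma enorm_lateralFlux_le {θ : Vec m → ℝ} {δ : ℝ} (hδ : 0 ≤ δ)
    (hθ : ∀ y (v : Vec m), ‖v‖ = 1 → |fderiv ℝ θ y v| ≤ δ) (H f : ParaVec m → Cl m)
    (t : ℝ) (y : Vec m) : ‖lateralFlux θ H f t y‖ₑ ≤
      ENNReal.ofReal (δ * fluxBound m) * (‖H (t, y)‖ₑ ^ 2 + ‖f (t, y)‖ₑ ^ 2) := by
  have h1 : ‖lateralFlux θ H f t y‖ ≤
      δ * fluxBound m * (‖H (t, y)‖ ^ 2 + ‖f (t, y)‖ ^ 2) := by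
    unfold lateralFlux fluxBound
    rw [Finset.mul_sum, Finset.sum_mul]
    refine (norm_sum_le _ _).trans (Finset.sum_le_sum fun k _ => ?_)
    rw [norm_smul, mul_assoc δ]
    refine mul_le_mul (hθ y _ (by rw [PiLp.norm_single, norm_one])) ?_ (norm_nonneg _) hδ
    have h2 := norm_mul_le_const (H (t, y) * gen k) (f (t, y))
    have h3 := norm_mul_le_const (H (t, y)) (gen k)
    calc _ ≤ ‖mulC m‖ * (‖mulC m‖ * ‖H (t, y)‖ * ‖gen k‖) * ‖f (t, y)‖ := by
          refine h2.trans ?_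
          gcongr
      _ = ‖mulC m‖ * (‖mulC m‖ * ‖gen k‖) * (‖H (t, y)‖ * ‖f (t, y)‖) := by ring
      _ ≤ _ := by
          gcongr
          nlinarith [sq_nonneg (‖H (t, y)‖ - ‖f (t, y)‖), sq_nonneg ‖H (t, y)‖,
            sq_nonneg ‖f (t, y)‖]
  rw [← ofReal_norm]
  refine (ENNReal.ofReal_le_ofReal h1).trans (le_of_eq ?_)
  rw [ENNReal.ofReal_mul (mul_nonneg hδ (fluxBound_nonneg m)),
    ENNReal.ofReal_add (by positivity) (by positivity), ENNReal.ofReal_pow (norm_nonneg _),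
    ENNReal.ofReal_pow (norm_nonneg _), ofReal_norm, ofReal_norm]

lemma memLp_slice {f : ParaVec m → Cl m} {t : ℝ} (hf : Continuous fun y : Vec m => f (t, y))
    (h : sliceNorm f t < ⊤) : MemLp (fun y => f (t, y)) 2 :=
  (memLp_two_iff hf.aestronglyMeasurable).2 h

lemma IsLeftMonogenic.continuous_slice {ε a : ℝ} {f : ParaVec m → Cl m}
    (hf : IsLeftMonogenic f (halfSpace m ε a)) {t : ℝ} (ht : -a < ε * t) :
    Continuous fun y : Vec m => f (t, y) := by
  have hsl : Continuous fun y : Vec m => ((t, y) : ParaVec m) := by fun_prop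
  exact continuous_iff_continuousAt.2 fun y => ContinuousAt.comp
    (hf.1.contDiffAt ((isOpen_halfSpace ε a).mem_nhds ht)).continuousAt hsl.continuousAt

lemma integrable_cl_mul {α : Type*} [MeasurableSpace α] {μ : Measure α} {h f : α → Cl m}
    (hh : MemLp h 2 μ) (hf : MemLp f 2 μ) : Integrable (fun x => h x * f x) μ := by
  have h1 : MemLp (fun x => conj (h x)) 2 μ :=
    hh.of_le (continuous_conj.comp_aestronglyMeasurable hh.1)
      (ae_of_all _ fun x => (norm_conj (h x)).le)
  simpa only [conj_conj] using integrable_conj_mul h1 hf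

lemma tendsto_integral_cutoff {θ : ℕ → Vec m → ℝ} (h1 : ∀ n, ContDiff ℝ 1 (θ n))
    (h2 : ∀ n y, |θ n y| ≤ 1) (h3 : ∀ y, ∀ᶠ n in atTop, θ n y = 1) {F : Vec m → Cl m}
    (hF : Integrable F) : Tendsto (fun n => ∫ y, θ n y • F y) atTop (𝓝 (∫ y, F y)) := by
  refine tendsto_integral_of_dominated_convergence (fun y => ‖F y‖)
    (fun n => (h1 n).continuous.aestronglyMeasurable.smul hF.1) hF.norm
    (fun n => ae_of_all _ fun y => ?_) (ae_of_all _ fun y => ?_)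
  · rw [norm_smul, Real.norm_eq_abs]
    exact mul_le_of_le_one_left (norm_nonneg _) (h2 n y)
  · refine tendsto_const_nhds.congr' ?_
    filter_upwards [h3 y] with n hn
    rw [hn, one_smul]

/-- Cauchy's theorem: the pairing of a right-monogenic and a left-monogenic function over the
slices does not depend on the slice. -/
lemma integral_slice_eq {ε a : ℝ} {H f : ParaVec m → Cl m} (hH : IsRightMonogenic H)
    (hf : IsLeftMonogenic f (halfSpace m ε a)) {s t : ℝ} (hst : s ≤ t)
    (hI : ∀ τ ∈ Set.Icc s t, -a < ε * τ) {M : ℝ≥0∞} (hM : M < ⊤)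
    (hHM : ∀ τ ∈ Set.Icc s t, sliceNorm H τ ≤ M)
    (hfM : ∫⁻ τ in Set.Ioc s t, sliceNorm f τ < ⊤) (hs : sliceNorm f s < ⊤)
    (ht : sliceNorm f t < ⊤) :
    ∫ y, H (t, y) * f (t, y) = ∫ y, H (s, y) * f (s, y) := by
  obtain ⟨θ, C, hC0, θ1, θ2, θ3, θ4, θ5⟩ := exists_cutoff m
  have hHc : ∀ τ, Continuous fun y : Vec m => H (τ, y) := fun τ =>
    hH.1.continuous.comp (by fun_prop)
  have hint : ∀ τ ∈ Set.Icc s t, sliceNorm f τ < ⊤ → Integrable fun y => H (τ, y) * f (τ, y) :=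
    fun τ hτ hN => integrable_cl_mul (memLp_slice (hHc τ) ((hHM τ hτ).trans_lt hM))
      (memLp_slice (hf.continuous_slice (hI τ hτ)) hN)
  have hlim := (tendsto_integral_cutoff θ1 θ3 θ4 (hint t ⟨hst, le_rfl⟩ ht)).sub
    (tendsto_integral_cutoff θ1 θ3 θ4 (hint s ⟨le_rfl, hst⟩ hs))
  -- `A` bounds the total lateral flux up to the gradient factor. Between the two end slices only
  -- integrability of `τ ↦ sliceNorm f τ` is used, which is what the Bergman condition supplies.
  set A : ℝ≥0∞ := ∫⁻ τ in Set.Ioc s t, (M + sliceNorm f τ) with hA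
  have hA' : A < ⊤ := by
    rw [hA, lintegral_add_left measurable_const]
    refine ENNReal.add_lt_top.2 ⟨?_, hfM⟩
    rw [setLIntegral_const]
    exact ENNReal.mul_lt_top hM measure_Ioc_lt_top
  have hbound : ∀ n : ℕ, ‖(∫ y, θ n y • (H (t, y) * f (t, y))) -
      ∫ y, θ n y • (H (s, y) * f (s, y))‖ ≤ C / (n + 1) * fluxBound m * A.toReal := by
    intro n
    have h0 : 0 ≤ C / (n + 1 : ℝ) * fluxBound m :=
      mul_nonneg (by positivity) (fluxBound_nonneg m)
    rw [integral_slice_sub hH hf hst hI (θ1 n) (θ2 n)]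
    have h1 : ‖∫ τ in Set.Ioc s t, ∫ y, lateralFlux (θ n) H f τ y‖ₑ ≤
        ENNReal.ofReal (C / (n + 1) * fluxBound m) * A := by
      rw [hA, ← lintegral_const_mul' _ _ ENNReal.ofReal_ne_top]
      refine (enorm_integral_le_lintegral_enorm _).trans (setLIntegral_mono' measurableSet_Ioc
        fun τ hτ => (enorm_integral_le_lintegral_enorm _).trans ?_)
      refine (lintegral_mono fun y => enorm_lateralFlux_le (by positivity) (θ5 n) H f τ y).trans ?_
      rw [lintegral_const_mul' _ _ ENNReal.ofReal_ne_top, lintegral_add_left]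
      · gcongr
        · exact hHM τ ⟨hτ.1.le, hτ.2⟩
        · exact le_rfl
      · exact (hHc τ).measurable.enorm.pow_const 2
    have h2 := ENNReal.toReal_mono (ENNReal.mul_ne_top ENNReal.ofReal_ne_top hA'.ne) h1
    rwa [toReal_enorm, ENNReal.toReal_mul, ENNReal.toReal_ofReal h0] at h2
  have hzero : Tendsto (fun n : ℕ => C / (n + 1) * fluxBound m * A.toReal) atTop (𝓝 0) := by
    have h1 := tendsto_one_div_add_atTop_nhds_zero_nat (𝕜 := ℝ)
    have h2 := ((h1.const_mul C).mul_const (fluxBound m)).mul_const A.toReal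
    simpa [div_eq_mul_inv] using h2
  have := tendsto_nhds_unique hlim (squeeze_zero_norm hbound hzero)
  exact sub_eq_zero.1 this

/-! ### Fourier analysis of the slices of a monogenic function -/

lemma expDecay_indicator {K : Set (Vec m)} (hK : IsCompact K) (a : ℝ) :
    ExpDecay a (K.indicator fun _ => (1 : Cl m)) := by
  have hm : AEStronglyMeasurable (K.indicator fun _ => (1 : Cl m)) :=
    aestronglyMeasurable_const.indicator hK.measurableSet
  refine ⟨hm, fun b _ => ?_⟩
  obtain ⟨R, hR⟩ := hK.isBounded.exists_norm_le
  have h1 : MemLp (K.indicator fun _ => (1 : Cl m)) 2 :=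
    memLp_indicator_const 2 hK.measurableSet 1 (Or.inr hK.measure_lt_top.ne)
  refine MemLp.of_le_mul (c := Real.exp (|b| * |R|)) h1
    ((measurable_exp_mul_norm b).aestronglyMeasurable.smul hm) (ae_of_all _ fun ξ => ?_)
  by_cases hξ : ξ ∈ K
  · rw [norm_smul, Real.norm_of_nonneg (Real.exp_pos _).le]
    gcongr
    · exact le_abs_self b
    · exact (hR ξ hξ).trans (le_abs_self R)
  · simp [hξ]

lemma mem_halfSpace_abs {σ : ℝ} (hσ : σ = 1 ∨ σ = -1) {B : ℝ} {x : ParaVec m} (hx : |x.1| ≤ B) :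
    x ∈ halfSpace m σ (B + 1) := by
  change -(B + 1) < σ * x.1
  have := abs_le.1 hx
  rcases hσ with rfl | rfl <;> linarith

/-- The right-monogenic function `x ↦ conj G(-x₀ + x̲)`, where `G` is the superposition of the
monogenic exponentials over a compact set. -/
noncomputable def dualTest (σ : ℝ) (K : Set (Vec m)) (x : ParaVec m) : Cl m :=
  conj (monInt σ (K.indicator fun _ => (1 : Cl m)) (-x.1, x.2))

/-- Conjugation reverses products and sends `e_k` to `-e_k`, turning `∂₀ + ∑ e_k ∂_k` on the left
into `∂₀ - ∑ ∂_k e_k` on the right; the reflection `x₀ ↦ -x₀` corrects the relative sign. -/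
lemma isRightMonogenic_dualTest {σ : ℝ} (hσ : σ = 1 ∨ σ = -1) {K : Set (Vec m)}
    (hK : IsCompact K) : IsRightMonogenic (dualTest σ K) := by
  set G : ParaVec m → Cl m := monInt σ (K.indicator fun _ => (1 : Cl m)) with hG
  have hmon : ∀ x : ParaVec m, ContDiffAt ℝ 1 G x ∧ dirac G x = 0 := by
    intro x
    -- The compactly supported density decays at every rate, so `G` is monogenic on all of space;
    -- the half-space is chosen to contain the point at hand.
    have h1 := isLeftMonogenic_monInt hσ (expDecay_indicator hK (|x.1| + 1))
    have h2 := mem_halfSpace_abs (m := m) hσ (x := x) le_rfl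
    exact ⟨h1.1.contDiffAt ((isOpen_halfSpace _ _).mem_nhds h2), h1.2 x h2⟩
  let R : ParaVec m →L[ℝ] ParaVec m :=
    (-ContinuousLinearMap.fst ℝ ℝ (Vec m)).prod (ContinuousLinearMap.snd ℝ ℝ (Vec m))
  let J : Cl m →L[ℝ] Cl m := (conjL m).toContinuousLinearEquiv.toContinuousLinearMap
  have heq : dualTest σ K = fun x => J (G (R x)) := rfl
  have hGc : ContDiff ℝ 1 G := contDiff_iff_contDiffAt.2 fun x => (hmon x).1
  refine ⟨by rw [heq]; exact J.contDiff.comp (hGc.comp R.contDiff), fun x => ?_⟩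
  have hd : HasFDerivAt (dualTest σ K) (J.comp ((fderiv ℝ G (R x)).comp R)) x := by
    rw [heq]
    exact J.hasFDerivAt.comp x
      ((hGc.differentiable one_ne_zero (R x)).hasFDerivAt.comp x R.hasFDerivAt)
  have hv : ∀ v, fderiv ℝ (dualTest σ K) x v = conj (fderiv ℝ G (R x) (-v.1, v.2)) := by
    intro v
    rw [hd.fderiv]
    rfl
  have h1 : ((-1 : ℝ), (0 : Vec m)) = -((1 : ℝ), (0 : Vec m)) := by simp
  have h2 := congrArg conj (hmon (R x)).2
  have h0 : conj (0 : Cl m) = 0 := map_zero (conjL m)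
  rw [dirac, conj_add, conj_sum, h0] at h2
  simp only [hv, neg_zero, h1, map_neg, conj_neg]
  rw [← neg_eq_zero, ← h2, neg_add, neg_neg, ← Finset.sum_neg_distrib]
  congr 1
  refine Finset.sum_congr rfl fun k _ => ?_
  rw [conj_mul, conj_gen, mul_neg]

lemma sliceNorm_dualTest (σ : ℝ) (K : Set (Vec m)) (t : ℝ) : sliceNorm (dualTest σ K) t =
    ∫⁻ y, ‖monInt σ (K.indicator fun _ => (1 : Cl m)) (-t, y)‖ₑ ^ 2 := by
  refine lintegral_congr fun y => ?_
  rw [dualTest, ← ofReal_norm, norm_conj, ofReal_norm]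

lemma exists_sliceNorm_dualTest_le {σ : ℝ} (hσ : σ = 1 ∨ σ = -1) {K : Set (Vec m)}
    (hK : IsCompact K) (B : ℝ) :
    ∃ M : ℝ≥0∞, M < ⊤ ∧ ∀ t, |t| ≤ B → sliceNorm (dualTest σ K) t ≤ M := by
  set c : Vec m → Cl m := K.indicator fun _ => (1 : Cl m)
  refine ⟨ENNReal.ofReal (((2 * Real.pi) ^ m)⁻¹) *
    ∫⁻ ξ, ‖Real.exp (B * ‖ξ‖) • (chi σ ξ * c ξ)‖ₑ ^ 2, ?_, fun t ht => ?_⟩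
  · have h1 := ((expDecay_indicator hK (B + 1)).chi_mul hσ).2 B (by linarith)
    exact ENNReal.mul_lt_top ENNReal.ofReal_lt_top ((memLp_two_iff h1.1).1 h1)
  · have h1 := mem_halfSpace_abs (m := m) hσ (x := (-t, 0)) (B := B) (by simpa using ht)
    rw [sliceNorm_dualTest, (isFourierTransformL2_monInt hσ
      (expDecay_indicator hK (B + 1)) h1).lintegral_eq]
    gcongr with ξ
    rw [enorm_smul, enorm_smul, Real.enorm_of_nonneg (Real.exp_pos _).le,
      Real.enorm_of_nonneg (Real.exp_pos _).le]
    gcongr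
    have := abs_le.1 ht
    rcases hσ with rfl | rfl <;> linarith

/-- The slice of the test function at `t` is the conjugate of the slice of `G` at `-t`, whose
transform is `e^{σt|ξ|} χ_σ` on `K`. Parseval and `conj χ_σ = χ_σ` give the rest. -/
lemma integral_dualTest_mul {σ : ℝ} (hσ : σ = 1 ∨ σ = -1) {K : Set (Vec m)}
    (hK : IsCompact K) {f : ParaVec m → Cl m} {t : ℝ} {g : Vec m → Cl m}
    (hg : IsFourierTransformL2 (fun y => f (t, y)) g) :
    ∫ y, dualTest σ K (t, y) * f (t, y) = ((2 * Real.pi) ^ m)⁻¹ •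
      ∫ ξ in K, Real.exp (σ * t * ‖ξ‖) • (chi σ ξ * g ξ) := by
  have h1 := mem_halfSpace_abs (m := m) hσ (x := (-t, 0)) (B := |t|) (by simp)
  have h2 := (isFourierTransformL2_monInt hσ (expDecay_indicator hK (|t| + 1)) h1).integral_conj_mul
    hg
  refine h2.trans ?_
  rw [← integral_indicator hK.measurableSet]
  congr 2
  funext ξ
  by_cases hξ : ξ ∈ K
  · simp only [hξ, Set.indicator_of_mem, mul_one, mul_neg, neg_neg]
    rw [conj_real_smul, conj_chi, real_smul_mul]
  · have h0 : conj (0 : Cl m) = 0 := map_zero (conjL m)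
    simp [hξ, h0]

lemma integrableOn_exp_smul_chi_mul {σ : ℝ} (hσ : σ = 1 ∨ σ = -1) {g : Vec m → Cl m}
    (hg : MemLp g 2) (b : ℝ) {K : Set (Vec m)} (hK : IsCompact K) :
    IntegrableOn (fun ξ => Real.exp (b * ‖ξ‖) • (chi σ ξ * g ξ)) K := by
  have h1 : MemLp (fun ξ => chi σ ξ * g ξ) 2 :=
    MemLp.of_le_mul hg (aestronglyMeasurable_chi_mul hg.1 σ)
      (ae_of_all _ fun ξ => norm_chi_mul_le hσ ξ (g ξ))
  have h2 : IntegrableOn (fun ξ => chi σ ξ * g ξ) K :=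
    (h1.locallyIntegrable (by norm_num)).integrableOn_isCompact hK
  have h3 : Continuous fun ξ : Vec m => Real.exp (b * ‖ξ‖) := by fun_prop
  exact h2.continuousOn_smul h3.continuousOn hK

/-- The integrated form of `∂_t(χ_σ g_t) = -σ|ξ| χ_σ g_t`. Cauchy's theorem for the test functions
equates the integrals of the two sides over every compact set, hence the sides themselves almost
everywhere. -/
lemma chi_mul_fourier_ae_eq {ε a : ℝ} {f : ParaVec m → Cl m}
    (hf : IsLeftMonogenic f (halfSpace m ε a)) {s t : ℝ} (hst : s ≤ t)
    (hI : ∀ τ ∈ Set.Icc s t, -a < ε * τ)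
    (hfM : ∫⁻ τ in Set.Ioc s t, sliceNorm f τ < ⊤) {gs gt : Vec m → Cl m}
    (hs : IsFourierTransformL2 (fun y => f (s, y)) gs)
    (ht : IsFourierTransformL2 (fun y => f (t, y)) gt) {σ : ℝ} (hσ : σ = 1 ∨ σ = -1) :
    (fun ξ => Real.exp (σ * t * ‖ξ‖) • (chi σ ξ * gt ξ)) =ᵐ[volume]
      fun ξ => Real.exp (σ * s * ‖ξ‖) • (chi σ ξ * gs ξ) := by
  have hN : ∀ {τ : ℝ} {g : Vec m → Cl m}, IsFourierTransformL2 (fun y => f (τ, y)) g →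
      sliceNorm f τ < ⊤ := fun h => (memLp_two_iff h.1.1).1 h.1
  have hit := fun {K : Set (Vec m)} (hK : IsCompact K) =>
    integrableOn_exp_smul_chi_mul hσ ht.memLp_right (σ * t) hK
  have his := fun {K : Set (Vec m)} (hK : IsCompact K) =>
    integrableOn_exp_smul_chi_mul hσ hs.memLp_right (σ * s) hK
  have key := ae_eq_zero_of_forall_setIntegral_isCompact_eq_zero' (μ := volume)
    (f := fun ξ => Real.exp (σ * t * ‖ξ‖) • (chi σ ξ * gt ξ) -
      Real.exp (σ * s * ‖ξ‖) • (chi σ ξ * gs ξ))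
    (locallyIntegrable_iff.2 fun K hK => (hit hK).sub (his hK)) fun K hK => by
      obtain ⟨M, hM, hHM⟩ := exists_sliceNorm_dualTest_le hσ hK (max |s| |t|)
      have h1 := integral_slice_eq (isRightMonogenic_dualTest hσ hK) hf hst hI hM
        (fun τ hτ => hHM τ (abs_le_max_abs_abs hτ.1 hτ.2)) hfM (hN hs) (hN ht)
      rw [integral_dualTest_mul hσ hK ht, integral_dualTest_mul hσ hK hs] at h1
      rw [integral_sub (hit hK) (his hK), sub_eq_zero]
      exact smul_right_injective (Cl m) (by positivity : ((2 * Real.pi) ^ m)⁻¹ ≠ 0) h1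
  filter_upwards [key] with ξ hξ
  exact sub_eq_zero.1 hξ

/-! ### The representation theorem -/

lemma ae_ne_zero_vec (hm : 1 ≤ m) : ∀ᵐ ξ : Vec m, ξ ≠ 0 := by
  have : Nonempty (Fin m) := ⟨⟨0, hm⟩⟩
  exact Measure.ae_ne volume (0 : Vec m)

/-- A measurable function whose integrals against `e^{2n|ξ|}` stay bounded vanishes. -/
lemma ae_eq_zero_of_exp_bound (hm : 1 ≤ m) {p : Vec m → ℝ≥0∞} (hp : AEMeasurable p)
    {C : ℝ≥0∞} (hC : C < ⊤)
    (h : ∀ n : ℕ, ∫⁻ ξ, ENNReal.ofReal (Real.exp (2 * n * ‖ξ‖)) * p ξ ≤ C) :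
    p =ᵐ[volume] 0 := by
  -- `n|ξ| ≤ e^{2n|ξ|}`, so every multiple of `∫ |ξ| p` is at most the finite `C`, which forces that
  -- integral to vanish.
  have h1 : ∀ n : ℕ, (n : ℝ≥0∞) * ∫⁻ ξ, ‖ξ‖ₑ * p ξ ≤ C := by
    intro n
    rw [← lintegral_const_mul' _ _ (ENNReal.natCast_ne_top n)]
    refine (lintegral_mono fun ξ => ?_).trans (h n)
    rw [← mul_assoc]
    gcongr
    rw [← ofReal_norm, ← ENNReal.ofReal_natCast n, ← ENNReal.ofReal_mul (by positivity)]
    refine ENNReal.ofReal_le_ofReal ?_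
    have := Real.add_one_le_exp (2 * n * ‖ξ‖)
    have h0 : 0 ≤ n * ‖ξ‖ := by positivity
    linarith
  have h2 : ∫⁻ ξ, ‖ξ‖ₑ * p ξ = 0 := by
    by_contra h0
    obtain ⟨n, hn⟩ := ENNReal.exists_nat_mul_gt h0 hC.ne
    exact absurd (h1 n) (not_le.2 hn)
  rw [lintegral_eq_zero_iff' (by fun_prop)] at h2
  filter_upwards [h2, ae_ne_zero_vec hm] with ξ h3 h4
  rcases mul_eq_zero.1 h3 with h5 | h5
  · exact absurd (enorm_eq_zero.1 h5) h4
  · exact h5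

lemma enorm_exp_smul_sq (b : ℝ) (ξ : Vec m) (x : Cl m) :
    ‖Real.exp (b * ‖ξ‖) • x‖ₑ ^ 2 = ENNReal.ofReal (Real.exp (2 * b * ‖ξ‖)) * ‖x‖ₑ ^ 2 := by
  rw [enorm_smul, mul_pow, Real.enorm_of_nonneg (Real.exp_pos _).le,
    ← ENNReal.ofReal_pow (Real.exp_pos _).le, ← Real.exp_nat_mul]
  congr 3
  push_cast
  ring

lemma exp_smul_eq_iff {b b' : ℝ} {ξ : Vec m} {x y : Cl m}
    (h : Real.exp (b * ‖ξ‖) • x = Real.exp (b' * ‖ξ‖) • y) :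
    Real.exp ((b - b') * ‖ξ‖) • x = y := by
  have := congrArg (fun z => Real.exp (-b' * ‖ξ‖) • z) h
  simp only [smul_smul, ← Real.exp_add] at this
  rw [show -b' * ‖ξ‖ + b' * ‖ξ‖ = 0 by ring, Real.exp_zero, one_smul] at this
  rw [← this]
  congr 2
  ring

/-- A left-monogenic function on a half-space with locally integrable slice norms which do not tend
to infinity is a superposition of monogenic exponentials. -/
theorem exists_monInt_eq (hm : 1 ≤ m) {ε a : ℝ} (hε : ε = 1 ∨ ε = -1) {f : ParaVec m → Cl m}
    (hf : IsLeftMonogenic f (halfSpace m ε a))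
    (h0 : ∀ᵐ t ∂volume.restrict {t : ℝ | -a < ε * t}, sliceNorm f t < ⊤)
    (h1 : ∀ s t : ℝ, -a < ε * s → -a < ε * t → ∫⁻ τ in Set.Ioc s t, sliceNorm f τ < ⊤)
    {C : ℝ≥0∞} (hC : C < ⊤) (h2 : ∀ T : ℝ, ∃ t, T ≤ ε * t ∧ -a < ε * t ∧ sliceNorm f t ≤ C) :
    ∃ c : Vec m → Cl m, ExpDecay a c ∧ Set.EqOn f (monInt ε c) (halfSpace m ε a) := by
  have hee : ε * ε = 1 := by rcases hε with h | h <;> simp [h]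
  have hnε : -ε = 1 ∨ -ε = -1 := by rcases hε with h | h <;> simp [h]
  have hFT : ∀ t, -a < ε * t → sliceNorm f t < ⊤ →
      ∃ g, IsFourierTransformL2 (fun y => f (t, y)) g := fun t ht hN =>
    exists_isFourierTransformL2 (memLp_slice (hf.continuous_slice ht) hN)
  have hI : ∀ s t τ : ℝ, -a < ε * s → -a < ε * t → τ ∈ Set.Icc s t → -a < ε * τ := by
    intro s t τ hs ht hτ
    rcases hε with rfl | rfl
    · linarith [hτ.1]
    · linarith [hτ.2]
  have hrel : ∀ {s t : ℝ} {gs gt : Vec m → Cl m}, -a < ε * s → -a < ε * t →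
      IsFourierTransformL2 (fun y => f (s, y)) gs → IsFourierTransformL2 (fun y => f (t, y)) gt →
      ∀ {σ : ℝ}, σ = 1 ∨ σ = -1 →
      (fun ξ => Real.exp (σ * t * ‖ξ‖) • (chi σ ξ * gt ξ)) =ᵐ[volume]
        fun ξ => Real.exp (σ * s * ‖ξ‖) • (chi σ ξ * gs ξ) := by
    intro s t gs gt hs ht hgs hgt σ hσ
    rcases le_total s t with hst | hst
    · exact chi_mul_fourier_ae_eq hf hst (fun τ => hI s t τ hs ht) (h1 s t hs ht) hgs hgt hσ
    · exact (chi_mul_fourier_ae_eq hf hst (fun τ => hI t s τ ht hs) (h1 t s ht hs) hgt hgs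
        hσ).symm
  -- the component on which the exponentials grow vanishes
  have hvan : ∀ {s : ℝ} {gs : Vec m → Cl m}, -a < ε * s →
      IsFourierTransformL2 (fun y => f (s, y)) gs → ∀ᵐ ξ, chi (-ε) ξ * gs ξ = 0 := by
    intro s gs hs hgs
    set P : ℝ≥0∞ := ENNReal.ofReal (((2 * Real.pi) ^ m)⁻¹) with hP
    have hP0 : P ≠ 0 := by
      rw [hP, Ne, ENNReal.ofReal_eq_zero, not_le]
      positivity
    have hPt : P ≠ ⊤ := ENNReal.ofReal_ne_top
    set Q : ℝ≥0∞ := ENNReal.ofReal (chiBound m ^ 2) with hQ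
    have hC' : Q * (P⁻¹ * C) < ⊤ :=
      ENNReal.mul_lt_top ENNReal.ofReal_lt_top (ENNReal.mul_lt_top (by simpa using hP0.bot_lt) hC)
    have hz := ae_eq_zero_of_exp_bound hm (p := fun ξ => ‖chi (-ε) ξ * gs ξ‖ₑ ^ 2)
      ((aestronglyMeasurable_chi_mul hgs.memLp_right.1 (-ε)).enorm.pow_const 2) hC' fun n => by
        -- `|χ_{-ε} g_t| = e^{ε(t-s)|ξ|} |χ_{-ε} g_s|`, and `ε(t - s) ≥ n`. The bounded norm of the
        -- far slice therefore controls `χ_{-ε} g_s` with the weight `e^{2n|ξ|}`, uniformly in `n`.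
        obtain ⟨t, ht1, ht2, ht3⟩ := h2 (ε * s + n)
        obtain ⟨gt, hgt⟩ := hFT t ht2 (ht3.trans_lt hC)
        have h3 := hgt.lintegral_eq
        have h4 : ∫⁻ ξ, ‖gt ξ‖ₑ ^ 2 ≤ P⁻¹ * C := by
          rw [← ENNReal.mul_le_iff_le_inv hP0 hPt, ← h3]
          exact ht3
        calc _ ≤ ∫⁻ ξ, Q * ‖gt ξ‖ₑ ^ 2 := by
              refine lintegral_mono_ae ?_
              filter_upwards [hrel hs ht2 hgs hgt hnε] with ξ hξ
              have h5 := exp_smul_eq_iff hξ.symm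
              have h6 : ENNReal.ofReal (Real.exp (2 * n * ‖ξ‖)) * ‖chi (-ε) ξ * gs ξ‖ₑ ^ 2 ≤
                  ‖chi (-ε) ξ * gt ξ‖ₑ ^ 2 := by
                rw [← h5, enorm_exp_smul_sq]
                gcongr
                linarith
              refine h6.trans ?_
              have h7 := norm_chi_mul_le hnε ξ (gt ξ)
              rw [hQ, ENNReal.ofReal_pow (chiBound_nonneg m), ← mul_pow, ← ofReal_norm,
                ← ofReal_norm, ← ENNReal.ofReal_mul (chiBound_nonneg m)]
              gcongr
          _ ≤ Q * (P⁻¹ * C) := by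
              rw [lintegral_const_mul' _ _ ENNReal.ofReal_ne_top]
              gcongr
    filter_upwards [hz] with ξ hξ
    simpa using hξ
  obtain ⟨s, -, hs, hsC⟩ := h2 0
  obtain ⟨gs, hgs⟩ := hFT s hs (hsC.trans_lt hC)
  -- The invariant `e^{εt|ξ|} χ_ε g_t`, evaluated at `t = s`. It is normalized at `x₀ = 0`, although
  -- that slice need not lie in the half-space here.
  set c : Vec m → Cl m := fun ξ => Real.exp (ε * s * ‖ξ‖) • (chi ε ξ * gs ξ) with hc
  have hcm : AEStronglyMeasurable c := (measurable_exp_mul_norm (ε * s)).aestronglyMeasurable.smul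
    (aestronglyMeasurable_chi_mul hgs.memLp_right.1 ε)
  have hslice : ∀ t, -a < ε * t → sliceNorm f t < ⊤ →
      IsFourierTransformL2 (fun y => f (t, y)) fun ξ => Real.exp (-(ε * t) * ‖ξ‖) • c ξ := by
    intro t ht hN
    obtain ⟨gt, hgt⟩ := hFT t ht hN
    refine hgt.congr_right ?_
    filter_upwards [hvan ht hgt, hrel hs ht hgs hgt hε] with ξ hξ1 hξ2
    simp only [hc]
    rw [← hξ2, smul_smul, ← Real.exp_add, show -(ε * t) * ‖ξ‖ + ε * t * ‖ξ‖ = 0 by ring,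
      Real.exp_zero, one_smul]
    calc gt ξ = (chi ε ξ + chi (-ε) ξ) * gt ξ := by rw [chi_add_chi_neg, one_mul]
      _ = _ := by rw [add_mul, hξ1, add_zero]
  have hDopen : IsOpen {t : ℝ | -a < ε * t} := isOpen_lt (by fun_prop) (by fun_prop)
  have hdec : ExpDecay a c := by
    refine ⟨hcm, fun b hb => ?_⟩
    have hUo : IsOpen {t : ℝ | -a < ε * t ∧ ε * t < -b} :=
      hDopen.inter (isOpen_lt (f := fun t : ℝ => ε * t) (g := fun _ => -b) (by fun_prop)
        (by fun_prop))
    obtain ⟨r, hr1, hr2⟩ := exists_between (show -a < -b by linarith)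
    have hne : {t : ℝ | -a < ε * t ∧ ε * t < -b}.Nonempty := ⟨ε * r, by
      constructor <;> rw [← mul_assoc, hee, one_mul] <;> assumption⟩
    -- Almost every slice has finite norm, so one exists in the nonempty open set `-a < εt < -b`.
    -- There `e^{-εt|ξ|} c` is in `L²` and dominates `e^{b|ξ|} c`.
    have h3 : ∃ t, (-a < ε * t ∧ ε * t < -b) ∧ sliceNorm f t < ⊤ := by
      by_contra! hcon
      have h4 := (ae_restrict_iff' hDopen.measurableSet).1 h0
      have h5 : volume {t : ℝ | -a < ε * t ∧ ε * t < -b} = 0 := by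
        refine measure_mono_null (fun t ht => ?_) (ae_iff.1 h4)
        simp only [Set.mem_ofPred_eq]
        exact fun h6 => absurd (h6 ht.1) (not_lt.2 (hcon t ht))
      exact (hUo.measure_pos volume hne).ne' h5
    obtain ⟨t, ⟨ht1, ht2⟩, ht3⟩ := h3
    have h4 := (hslice t ht1 ht3).memLp_right
    refine h4.of_le ((measurable_exp_mul_norm b).aestronglyMeasurable.smul hcm)
      (ae_of_all _ fun ξ => ?_)
    have h5 : ∀ r : ℝ, ‖Real.exp (r * ‖ξ‖) • c ξ‖ = Real.exp (r * ‖ξ‖) * ‖c ξ‖ := fun r => by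
      rw [norm_smul, Real.norm_of_nonneg (Real.exp_pos _).le]
    refine (h5 b).le.trans (le_trans ?_ (h5 (-(ε * t))).ge)
    exact mul_le_mul_of_nonneg_right (Real.exp_le_exp.2
      (mul_le_mul_of_nonneg_right (by linarith) (norm_nonneg ξ))) (norm_nonneg (c ξ))
  refine ⟨c, hdec, ?_⟩
  have hcont := (isLeftMonogenic_monInt hε hdec).1.continuousOn
  have hgood : ∀ t, -a < ε * t → sliceNorm f t < ⊤ → ∀ y, f (t, y) = monInt ε c (t, y) := by
    intro t ht hN
    have h3 := (isFourierTransformL2_monInt hε hdec ht).congr_right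
      (g' := fun ξ => Real.exp (-(ε * t) * ‖ξ‖) • c ξ) (by
        filter_upwards [ae_ne_zero_vec hm] with ξ hξ
        simp only [hc]
        rw [mul_real_smul, ← mul_assoc, chi_mul_self hε hξ])
    have h4 := (hslice t ht hN).ae_eq_left h3
    exact congrFun ((Continuous.ae_eq_iff_eq volume (hf.continuous_slice ht)
      ((isLeftMonogenic_monInt hε hdec).continuous_slice ht)).1 h4)
  rintro ⟨t, y⟩ hx
  have hsl : Continuous fun t : ℝ => ((t, y) : ParaVec m) := by fun_prop
  -- Equality is known on slices of finite norm, hence for almost every `t` at fixed `y`; continuity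
  -- in `t` extends it to the remaining slices.
  refine Measure.eqOn_open_of_ae_eq (μ := volume) (f := fun t => f (t, y))
    (g := fun t => monInt ε c (t, y)) (U := {t : ℝ | -a < ε * t}) ?_ hDopen ?_ ?_ hx
  · filter_upwards [h0, ae_restrict_mem hDopen.measurableSet] with t ht1 ht2
    exact hgood t ht2 ht1 y
  · exact hf.1.continuousOn.comp hsl.continuousOn fun t ht => ht
  · exact hcont.comp hsl.continuousOn fun t ht => ht

/-! ### Norms of the Bergman and Hardy spaces -/

lemma isOpen_times (ε a : ℝ) : IsOpen {t : ℝ | -a < ε * t} :=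
  isOpen_lt (by fun_prop) (by fun_prop)

lemma integrableOn_exp_times {ε : ℝ} (hε : ε = 1 ∨ ε = -1) (a : ℝ) {k : ℝ} (hk : 0 < k) :
    IntegrableOn (fun t => Real.exp (-(ε * t) * k)) {t : ℝ | -a < ε * t} := by
  rcases hε with rfl | rfl
  · have h1 : {t : ℝ | -a < 1 * t} = Set.Ioi (-a) := by
      ext t
      simp
    rw [h1]
    refine (integrableOn_exp_mul_Ioi (neg_lt_zero.2 hk) (-a)).congr_fun (fun t _ => ?_)
      measurableSet_Ioi
    simp only
    congr 1
    ring
  · have h1 : {t : ℝ | -a < -1 * t} = Set.Iio a := by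
      ext t
      simp
    rw [h1]
    refine ((integrableOn_exp_mul_Iic hk a).mono_set Set.Iio_subset_Iic_self).congr_fun
      (fun t _ => ?_) measurableSet_Iio
    simp only
    congr 1
    ring

/-- For `k = 2|ξ|` this is `e^{2a|ξ|}/(2|ξ|)`: the weight of the Bergman norm, and the reciprocal of
the Bergman kernel's weight. -/
lemma integral_exp_times {ε : ℝ} (hε : ε = 1 ∨ ε = -1) (a : ℝ) {k : ℝ} (hk : 0 < k) :
    ∫ t in {t : ℝ | -a < ε * t}, Real.exp (-(ε * t) * k) = Real.exp (a * k) / k := by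
  rcases hε with rfl | rfl
  · have h1 : {t : ℝ | -a < 1 * t} = Set.Ioi (-a) := by
      ext t
      simp
    have h2 := integral_exp_mul_Ioi (neg_lt_zero.2 hk) (-a)
    rw [h1, neg_div_neg_eq] at *
    rw [neg_mul_neg, mul_comm k] at h2
    rw [← h2]
    congr 1
    funext t
    congr 1
    ring
  · have h1 : {t : ℝ | -a < -1 * t} = Set.Iio a := by
      ext t
      simp
    have h2 := integral_exp_mul_Iic hk a
    rw [h1, ← integral_Iic_eq_integral_Iio, mul_comm a, ← h2]
    congr 1
    funext t
    congr 1
    ring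

lemma lintegral_exp_times {ε : ℝ} (hε : ε = 1 ∨ ε = -1) (a : ℝ) {k : ℝ} (hk : 0 < k) :
    ∫⁻ t in {t : ℝ | -a < ε * t}, ENNReal.ofReal (Real.exp (-(ε * t) * k)) =
      ENNReal.ofReal (Real.exp (a * k) / k) := by
  rw [← integral_exp_times hε a hk, ofReal_integral_eq_lintegral_ofReal
    (integrableOn_exp_times hε a hk) (ae_of_all _ fun t => (Real.exp_pos _).le)]

/-- Plancherel on each slice, then Tonelli, integrating in `t` first. -/
lemma lintegral_sliceNorm_monInt (hm : 1 ≤ m) {ε a : ℝ} (hε : ε = 1 ∨ ε = -1) {c : Vec m → Cl m}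
    (hc : ExpDecay a c) :
    ∫⁻ t in {t : ℝ | -a < ε * t}, sliceNorm (monInt ε c) t =
      ENNReal.ofReal (((2 * Real.pi) ^ m)⁻¹) * ∫⁻ ξ, ENNReal.ofReal
        (Real.exp (2 * a * ‖ξ‖) * (‖chi ε ξ * c ξ‖ ^ 2 / (2 * ‖ξ‖))) := by
  have h0 : Set.EqOn (sliceNorm (monInt ε c)) _ {t : ℝ | -a < ε * t} :=
    fun t ht => lintegral_monInt hε hc ht
  rw [setLIntegral_congr_fun (isOpen_times ε a).measurableSet h0, lintegral_const_mul' _ _ ENNReal.ofReal_ne_top]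
  congr 1
  have hq : AEMeasurable (fun ξ => ‖chi ε ξ * c ξ‖ₑ ^ 2) :=
    (aestronglyMeasurable_chi_mul hc.1 ε).enorm.pow_const 2
  rw [lintegral_lintegral_swap]
  · refine lintegral_congr_ae ?_
    filter_upwards [ae_ne_zero_vec hm] with ξ hξ
    have hk : 0 < 2 * ‖ξ‖ := by positivity
    rw [lintegral_mul_const' _ _ (by finiteness)]
    have h1 : ∀ t : ℝ, -(2 * (ε * t)) * ‖ξ‖ = -(ε * t) * (2 * ‖ξ‖) := fun t => by ring
    simp only [h1]
    rw [lintegral_exp_times hε a hk, ← ofReal_norm, ← ENNReal.ofReal_pow (norm_nonneg _),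
      ← ENNReal.ofReal_mul (by positivity)]
    congr 1
    ring_nf
  · refine AEMeasurable.mul ?_ (hq.comp_snd)
    fun_prop

lemma aestronglyMeasurable_halfSpace {ε a : ℝ} {f : ParaVec m → Cl m}
    (hf : IsLeftMonogenic f (halfSpace m ε a)) :
    AEStronglyMeasurable f (volume.restrict (halfSpace m ε a)) :=
  hf.1.continuousOn.aestronglyMeasurable (isOpen_halfSpace ε a).measurableSet

lemma restrict_halfSpace (ε a : ℝ) : (volume : Measure (ParaVec m)).restrict (halfSpace m ε a) =
    (volume.restrict {t : ℝ | -a < ε * t}).prod (volume : Measure (Vec m)) := by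
  have h1 : halfSpace m ε a = {t : ℝ | -a < ε * t} ×ˢ Set.univ := by
    ext x
    simp [halfSpace]
  rw [h1, Measure.volume_eq_prod, ← Measure.prod_restrict, Measure.restrict_univ]

lemma MemBergman.memLp {ε a : ℝ} {f : ParaVec m → Cl m} (hf : MemBergman ε a f) :
    MemLp f 2 (volume.restrict (halfSpace m ε a)) := by
  have h1 := aestronglyMeasurable_halfSpace hf.1
  rw [memLp_two_iff h1, restrict_halfSpace, lintegral_prod]
  · exact hf.2
  · rw [← restrict_halfSpace]
    exact h1.enorm.pow_const 2

/-- The representation of the functions in the Bergman space. -/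
theorem MemBergman.exists_monInt_eq (hm : 1 ≤ m) {ε a : ℝ} (hε : ε = 1 ∨ ε = -1)
    {f : ParaVec m → Cl m} (hf : MemBergman ε a f) :
    ∃ c : Vec m → Cl m, ExpDecay a c ∧ Set.EqOn f (monInt ε c) (halfSpace m ε a) := by
  have hN : ∫⁻ t in {t : ℝ | -a < ε * t}, sliceNorm f t < ⊤ := hf.2
  have hmeas : AEMeasurable (sliceNorm f) (volume.restrict {t : ℝ | -a < ε * t}) := by
    refine AEMeasurable.lintegral_prod_right' (f := fun x : ℝ × Vec m => ‖f x‖ₑ ^ 2) ?_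
    rw [← restrict_halfSpace]
    exact (aestronglyMeasurable_halfSpace hf.1).enorm.pow_const 2
  refine CliffordHalfSpace.exists_monInt_eq hm hε hf.1 (ae_lt_top' hmeas hN.ne)
    (fun s t hs ht => ?_) (C := 1) ENNReal.one_lt_top fun T => ?_
  · refine (lintegral_mono_set fun τ hτ => ?_).trans_lt hN
    change -a < ε * τ
    rcases hε with rfl | rfl
    · linarith [hτ.1]
    · linarith [hτ.2]
  · by_contra! hcon
    -- If all far slices had norm above `1` (an arbitrary threshold), the integral over this
    -- half-line of infinite length would diverge. The double negation matches the form `-a < ε *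
    -- t`.
    set U : Set ℝ := {t : ℝ | -(-max T (-a)) < ε * t} with hU
    have hUm : MeasurableSet U := (isOpen_times ε _).measurableSet
    have hUs : U ⊆ {t : ℝ | -a < ε * t} := fun t ht => by
      have h1 : -(-max T (-a)) < ε * t := ht
      rw [neg_neg] at h1
      exact (le_max_right _ _).trans_lt h1
    have h1 : ∫⁻ t in U, (1 : ℝ≥0∞) ≤ ∫⁻ t in U, sliceNorm f t := by
      refine setLIntegral_mono' hUm fun t ht => (hcon t ?_ (hUs ht)).le
      have h1 : -(-max T (-a)) < ε * t := ht
      rw [neg_neg] at h1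
      exact (le_max_left _ _).trans h1.le
    have h2 : volume U = ⊤ := by
      rw [hU]
      rcases hε with rfl | rfl
      · have : {t : ℝ | -(-max T (-a)) < 1 * t} = Set.Ioi (max T (-a)) := by
          ext t
          simp
        rw [this, Real.volume_Ioi]
      · have : {t : ℝ | -(-max T (-a)) < -1 * t} = Set.Iio (-max T (-a)) := by
          ext t
          simp only [Set.mem_ofPred_eq, Set.mem_Iio]
          constructor <;> intro h <;> linarith
        rw [this, Real.volume_Iio]
    rw [setLIntegral_one, h2, top_le_iff] at h1
    exact absurd (lintegral_mono_set hUs) (by rw [h1, not_le]; exact hN)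

/-- The representation of the functions in the Hardy space. -/
theorem MemHardy.exists_monInt_eq (hm : 1 ≤ m) {ε a : ℝ} (hε : ε = 1 ∨ ε = -1)
    {f : ParaVec m → Cl m} (hf : MemHardy ε a f) :
    ∃ c : Vec m → Cl m, ExpDecay a c ∧ Set.EqOn f (monInt ε c) (halfSpace m ε a) := by
  have hee : ε * ε = 1 := by rcases hε with h | h <;> simp [h]
  set C : ℝ≥0∞ := ⨆ t ∈ {t : ℝ | -a < ε * t}, ∫⁻ y : Vec m, ‖f (t, y)‖ₑ ^ 2 with hC
  have hle : ∀ t, -a < ε * t → sliceNorm f t ≤ C := fun t ht =>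
    le_iSup₂ (f := fun (t : ℝ) (_ : t ∈ {t : ℝ | -a < ε * t}) => ∫⁻ y : Vec m, ‖f (t, y)‖ₑ ^ 2)
      t ht
  have hCt : C < ⊤ := hf.2
  refine CliffordHalfSpace.exists_monInt_eq hm hε hf.1 ?_ (fun s t hs ht => ?_) hCt fun T => ?_
  · filter_upwards [ae_restrict_mem (isOpen_times ε a).measurableSet] with t ht
    exact (hle t ht).trans_lt hCt
  · have h1 : ∫⁻ τ in Set.Ioc s t, sliceNorm f τ ≤ ∫⁻ τ in Set.Ioc s t, C := by
      refine setLIntegral_mono' measurableSet_Ioc fun τ hτ => hle τ ?_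
      rcases hε with rfl | rfl
      · linarith [hτ.1]
      · linarith [hτ.2]
    refine h1.trans_lt ?_
    rw [setLIntegral_const]
    exact ENNReal.mul_lt_top hCt measure_Ioc_lt_top
  · have h1 : ε * (ε * max T (-a + 1)) = max T (-a + 1) := by rw [← mul_assoc, hee, one_mul]
    have h2 : -a < ε * (ε * max T (-a + 1)) := by
      rw [h1]
      exact (by linarith : -a < -a + 1).trans_le (le_max_right _ _)
    exact ⟨ε * max T (-a + 1), (le_max_left _ _).trans h1.ge, h2, hle _ h2⟩

/-! ### Membership criteria and the characterization of the Bergman space -/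

lemma IsLeftMonogenic.congr {Ω : Set (ParaVec m)} (hΩ : IsOpen Ω) {f f' : ParaVec m → Cl m}
    (hf : IsLeftMonogenic f Ω) (h : Set.EqOn f' f Ω) : IsLeftMonogenic f' Ω := by
  refine ⟨hf.1.congr h, fun x hx => ?_⟩
  have h1 : f' =ᶠ[𝓝 x] f := h.eventuallyEq_of_mem (hΩ.mem_nhds hx)
  have h2 := hf.2 x hx
  rw [dirac] at h2 ⊢
  rwa [h1.fderiv_eq]

lemma MemBergman.congr {ε a : ℝ} {f f' : ParaVec m → Cl m} (hf : MemBergman ε a f)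
    (h : Set.EqOn f' f (halfSpace m ε a)) : MemBergman ε a f' := by
  refine ⟨hf.1.congr (isOpen_halfSpace ε a) h, ?_⟩
  refine lt_of_eq_of_lt (setLIntegral_congr_fun (isOpen_times ε a).measurableSet
    fun t ht => lintegral_congr fun y => ?_) hf.2
  rw [h (show (t, y) ∈ halfSpace m ε a from ht)]

lemma memBergman_monInt_iff (hm : 1 ≤ m) {ε a : ℝ} (hε : ε = 1 ∨ ε = -1) {c : Vec m → Cl m}
    (hc : ExpDecay a c) : MemBergman ε a (monInt ε c) ↔ ∫⁻ ξ, ENNReal.ofReal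
        (Real.exp (2 * a * ‖ξ‖) * (‖chi ε ξ * c ξ‖ ^ 2 / (2 * ‖ξ‖))) < ⊤ := by
  have h1 := lintegral_sliceNorm_monInt hm hε hc
  have h0 : ENNReal.ofReal (((2 * Real.pi) ^ m)⁻¹) ≠ 0 := by
    rw [Ne, ENNReal.ofReal_eq_zero, not_le]
    positivity
  constructor
  · intro h
    have h2 : ∫⁻ t in {t : ℝ | -a < ε * t}, sliceNorm (monInt ε c) t < ⊤ := h.2
    rw [h1] at h2
    exact ENNReal.lt_top_of_mul_ne_top_right h2.ne h0
  · intro h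
    refine ⟨isLeftMonogenic_monInt hε hc, ?_⟩
    change ∫⁻ t in {t : ℝ | -a < ε * t}, sliceNorm (monInt ε c) t < ⊤
    rw [h1]
    exact ENNReal.mul_lt_top ENNReal.ofReal_lt_top h

/-- Decay at a rate beyond `a` puts `e^{a|ξ|} χ_ε c` itself in `L²`, and it dominates the transforms
of all slices in the half-space. Kernel densities have this extra room. -/
lemma memHardy_monInt {ε a : ℝ} (hε : ε = 1 ∨ ε = -1) {c : Vec m → Cl m} {a' : ℝ} (ha : a < a')
    (hc : ExpDecay a' c) : MemHardy ε a (monInt ε c) := by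
  have hca : ExpDecay a c := ⟨hc.1, fun b hb => hc.2 b (hb.trans ha)⟩
  refine ⟨isLeftMonogenic_monInt hε hca, ?_⟩
  have h1 := (hc.chi_mul hε).2 a ha
  refine lt_of_le_of_lt (iSup₂_le fun t ht => ?_) (ENNReal.mul_lt_top
    (ENNReal.ofReal_lt_top (r := ((2 * Real.pi) ^ m)⁻¹)) ((memLp_two_iff h1.1).1 h1))
  rw [(isFourierTransformL2_monInt hε hca ht).lintegral_eq]
  gcongr with ξ
  rw [enorm_smul, enorm_smul, Real.enorm_of_nonneg (Real.exp_pos _).le,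
    Real.enorm_of_nonneg (Real.exp_pos _).le]
  gcongr
  have : -a < ε * t := ht
  linarith

lemma monInt_chi_mul (hm : 1 ≤ m) {ε : ℝ} (hε : ε = 1 ∨ ε = -1) (c : Vec m → Cl m)
    (x : ParaVec m) :
    (fun ξ => monExp ε x ξ * (chi ε ξ * c ξ)) =ᵐ[volume] fun ξ => monExp ε x ξ * c ξ := by
  filter_upwards [ae_ne_zero_vec hm] with ξ hξ
  rw [monExp_mul, monExp_mul, ← mul_assoc, chi_mul_self hε hξ]

/-- `e^{2b|ξ|} ≤ (a - b)⁻¹ e^{2a|ξ|}/(2|ξ|)` by `norm_mul_exp_le`: the loss of `1/|ξ|` at infinity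
is covered by `b < a`. -/
lemma expDecay_of_weighted (hm : 1 ≤ m) {a : ℝ} {c : Vec m → Cl m}
    (hcm : AEStronglyMeasurable c) (h : ∫⁻ ξ, ENNReal.ofReal
      (Real.exp (2 * a * ‖ξ‖) * (‖c ξ‖ ^ 2 / (2 * ‖ξ‖))) < ⊤) : ExpDecay a c := by
  refine ⟨hcm, fun b hb => ?_⟩
  have hmb : AEStronglyMeasurable fun ξ => Real.exp (b * ‖ξ‖) • c ξ :=
    (measurable_exp_mul_norm b).aestronglyMeasurable.smul hcm
  rw [memLp_two_iff hmb]
  have hab : 0 < a - b := sub_pos.2 hb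
  calc _ ≤ ∫⁻ ξ, ENNReal.ofReal ((a - b)⁻¹) * ENNReal.ofReal
        (Real.exp (2 * a * ‖ξ‖) * (‖c ξ‖ ^ 2 / (2 * ‖ξ‖))) := by
        refine lintegral_mono_ae ?_
        filter_upwards [ae_ne_zero_vec hm] with ξ hξ
        have hξ' : 0 < ‖ξ‖ := norm_pos_iff.2 hξ
        rw [enorm_exp_smul_sq, ← ofReal_norm, ← ENNReal.ofReal_pow (norm_nonneg _),
          ← ENNReal.ofReal_mul (Real.exp_pos _).le, ← ENNReal.ofReal_mul (by positivity)]
        refine ENNReal.ofReal_le_ofReal ?_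
        have h1 := norm_mul_exp_le (by linarith : 2 * b < 2 * a) ξ
        have h2 : Real.exp (2 * b * ‖ξ‖) ≤ (2 * a - 2 * b)⁻¹ * Real.exp (2 * a * ‖ξ‖) / ‖ξ‖ := by
          rwa [le_div_iff₀ hξ', mul_comm]
        calc _ ≤ (2 * a - 2 * b)⁻¹ * Real.exp (2 * a * ‖ξ‖) / ‖ξ‖ * ‖c ξ‖ ^ 2 := by gcongr
          _ = _ := by
            rw [show 2 * a - 2 * b = 2 * (a - b) by ring]
            field_simp
    _ < ⊤ := by
        rw [lintegral_const_mul' _ _ ENNReal.ofReal_ne_top]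
        exact ENNReal.mul_lt_top ENNReal.ofReal_lt_top h

/-- The characterization of the Bergman space. -/
theorem memBergman_iff (hm : 1 ≤ m) {ε a : ℝ} (ha : 0 < a) (hε : ε = 1 ∨ ε = -1)
    (f : ParaVec m → Cl m) : MemBergman ε a f ↔
      ∃ g : Vec m → Cl m,
        MemLp g 2 volume ∧
        IsFourierTransformL2 (fun y => f (0, y)) g ∧
        ∫⁻ ξ : Vec m, ENNReal.ofReal
          (Real.exp (2 * a * ‖ξ‖) * (‖chi ε ξ * g ξ‖ ^ 2 / (2 * ‖ξ‖))) < ⊤ ∧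
        ∀ x ∈ halfSpace m ε a,
          Integrable (fun ξ : Vec m => monExp ε x ξ * g ξ) ∧
          f x = (1 / (2 * Real.pi) ^ m : ℝ) • ∫ ξ : Vec m, monExp ε x ξ * g ξ := by
  constructor
  · intro hf
    obtain ⟨c, hc, hfc⟩ := hf.exists_monInt_eq hm hε
    have hcc := hc.chi_mul hε
    have h0 : ∀ y : Vec m, ((0 : ℝ), y) ∈ halfSpace m ε a := fun y => by
      change -a < ε * 0
      linarith
    -- As `a > 0`, the slice `x₀ = 0` lies inside the half-space, and the exponential factor there
    -- is `1`.
    have hFT : IsFourierTransformL2 (fun y => f (0, y)) fun ξ => chi ε ξ * c ξ := by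
      have h1 := isFourierTransformL2_monInt hε hc (h0 0)
      simp only [mul_zero, neg_zero, zero_mul, Real.exp_zero, one_smul] at h1
      exact h1.congr_left (ae_of_all _ fun y => (hfc (h0 y)).symm)
    have hcong : ∀ x, (fun ξ => monExp ε x ξ * (chi ε ξ * c ξ)) =ᵐ[volume]
        fun ξ => monExp ε x ξ * c ξ := monInt_chi_mul hm hε c
    have heq : Set.EqOn (monInt ε fun ξ => chi ε ξ * c ξ) f (halfSpace m ε a) := fun x hx => by
      rw [hfc hx, monInt, monInt, integral_congr_ae (hcong x)]
    exact ⟨fun ξ => chi ε ξ * c ξ, hFT.memLp_right, hFT,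
      (memBergman_monInt_iff hm hε hcc).1 (hf.congr heq), fun x hx =>
        ⟨integrable_monExp_mul hε hcc hx, (heq hx).symm⟩⟩
  · rintro ⟨g, hg, -, hw, hx⟩
    have hd := expDecay_of_weighted hm (aestronglyMeasurable_chi_mul hg.1 ε) hw
    have hcong : ∀ x, (fun ξ => monExp ε x ξ * (chi ε ξ * g ξ)) =ᵐ[volume]
        fun ξ => monExp ε x ξ * g ξ := monInt_chi_mul hm hε g
    have hB : MemBergman ε a (monInt ε fun ξ => chi ε ξ * g ξ) := by
      rw [memBergman_monInt_iff hm hε hd]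
      refine lt_of_eq_of_lt (lintegral_congr_ae ?_) hw
      filter_upwards [ae_ne_zero_vec hm] with ξ hξ
      rw [← mul_assoc, chi_mul_self hε hξ]
    refine hB.congr fun x hxm => ?_
    rw [(hx x hxm).2, monInt, integral_congr_ae (hcong x)]

/-! ### Reproducing kernels -/

/-- The kernel `(2π)^{-m} ∫ p(ξ) e^±(w + x̄, ξ) dξ`. -/
noncomputable def expKernel (ε : ℝ) (p : Vec m → ℝ) (w x : ParaVec m) : Cl m :=
  monInt ε (fun ξ => p ξ • 1) (w + paraConj x)

/-- The density of the kernel `expKernel` as a function of its first variable. -/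
noncomputable def kernelDensity (ε : ℝ) (p : Vec m → ℝ) (x : ParaVec m) (ξ : Vec m) : Cl m :=
  Complex.exp (expForm ε ξ (paraConj x)) • p ξ • 1

/-- The exponent is additive in `w + x̄`, so the dependence on `x` can be moved into the density,
making the kernel a superposition of exponentials in `w`. -/
lemma expKernel_eq (ε : ℝ) (p : Vec m → ℝ) (w x : ParaVec m) :
    expKernel ε p w x = monInt ε (kernelDensity ε p x) w := by
  unfold expKernel monInt
  congr 2
  funext ξ
  rw [monExp_mul, monExp_mul, kernelDensity,
    mul_smul_comm (Complex.exp (expForm ε ξ (paraConj x))), smul_smul, map_add, Complex.exp_add]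

lemma conj_exp_expForm_paraConj (ε : ℝ) (x : ParaVec m) (ξ : Vec m) :
    (starRingEnd ℂ) (Complex.exp (expForm ε ξ (paraConj x))) = Complex.exp (expForm ε ξ x) := by
  rw [← Complex.exp_conj, expForm_apply, expForm_apply]
  congr 1
  simp [paraConj]

lemma ExpDecay.mono {a a' : ℝ} (h : a ≤ a') {c : Vec m → Cl m} (hc : ExpDecay a' c) :
    ExpDecay a c :=
  ⟨hc.1, fun b hb => hc.2 b (hb.trans_le h)⟩

/-- The `x`-factor has modulus `e^{-εx₀|ξ|}`, shifting the decay rate by `εx₀`. For `A = 2a` the new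
rate exceeds `a` exactly when `x` lies in the half-space. -/
lemma expDecay_kernelDensity {ε A : ℝ} {p : Vec m → ℝ}
    (hp : ExpDecay A fun ξ => p ξ • (1 : Cl m)) (x : ParaVec m) :
    ExpDecay (A + ε * x.1) (kernelDensity ε p x) := by
  have hm : AEStronglyMeasurable (kernelDensity ε p x) :=
    (measurable_exp_expForm ε (paraConj x)).aestronglyMeasurable.smul hp.1
  have hmb : ∀ b : ℝ, AEStronglyMeasurable fun ξ => Real.exp (b * ‖ξ‖) • kernelDensity ε p x ξ :=
    fun b => (measurable_exp_mul_norm b).aestronglyMeasurable.smul hm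
  refine ⟨hm, fun b hb => ?_⟩
  refine (hp.2 (b - ε * x.1) (by linarith)).of_le (hmb b) (ae_of_all _ fun ξ => le_of_eq ?_)
  rw [kernelDensity, norm_smul, norm_smul, norm_exp_expForm, norm_smul (Real.exp _),
    Real.norm_of_nonneg (Real.exp_pos _).le, Real.norm_of_nonneg (Real.exp_pos _).le,
    ← mul_assoc, ← Real.exp_add]
  congr 2
  simp only [paraConj]
  ring

/-- The pairing of the slices of the kernel and of a superposition of monogenic exponentials. -/
lemma integral_conj_expKernel_mul (hm : 1 ≤ m) {ε a A : ℝ} (hε : ε = 1 ∨ ε = -1) {p : Vec m → ℝ}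
    (hp : ExpDecay A fun ξ => p ξ • (1 : Cl m)) {c : Vec m → Cl m} (hc : ExpDecay a c)
    {x : ParaVec m} (hx : a ≤ A + ε * x.1) {f : ParaVec m → Cl m}
    (hf : Set.EqOn f (monInt ε c) (halfSpace m ε a)) {t : ℝ} (ht : -a < ε * t) :
    ∫ y : Vec m, conj (expKernel ε p (t, y) x) * f (t, y) =
      ∫ ξ, (((2 * Real.pi) ^ m)⁻¹ * (Real.exp (-(ε * t) * (2 * ‖ξ‖)) * p ξ)) •
        (monExp ε x ξ * c ξ) := by
  have h1 := isFourierTransformL2_monInt hε ((expDecay_kernelDensity hp x).mono hx) ht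
  have h2 := (h1.integral_conj_mul (isFourierTransformL2_monInt hε hc ht))
  have h3 : ∀ y : Vec m, f (t, y) = monInt ε c (t, y) := fun y => hf ht
  simp only [expKernel_eq, h3]
  rw [h2, ← integral_smul]
  -- After Parseval, conjugation turns the factor at `x̄` into the one at `x`, `χ_ε² = χ_ε` merges
  -- the two projections, and the two slice exponentials combine to `e^{-2εt|ξ|}`.
  refine integral_congr_ae ?_
  filter_upwards [ae_ne_zero_vec hm] with ξ hξ
  rw [conj_real_smul, conj_mul, conj_chi, kernelDensity, conj_smul, conj_exp_expForm_paraConj,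
    conj_real_smul, conj_one, monExp_mul, real_smul_mul, mul_real_smul, smul_mul_assoc,
    smul_mul_assoc, real_smul_mul, one_mul, real_smul_mul, ← mul_assoc, chi_mul_self hε hξ]
  simp only [smul_smul, real_smul_eq]
  congr 1
  have h4 : Real.exp (-(ε * t) * (2 * ‖ξ‖)) =
      Real.exp (-(ε * t) * ‖ξ‖) * Real.exp (-(ε * t) * ‖ξ‖) := by
    rw [← Real.exp_add]
    congr 1
    ring
  rw [h4]
  push_cast
  ring

/-- The weight of the Szegő kernel. -/
noncomputable def szegoWeight (a : ℝ) (ξ : Vec m) : ℝ := Real.exp (-(2 * a * ‖ξ‖))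

/-- The weight of the Bergman kernel. -/
noncomputable def bergmanWeight (a : ℝ) (ξ : Vec m) : ℝ := 2 * ‖ξ‖ * Real.exp (-(2 * a * ‖ξ‖))

lemma measurable_szegoWeight (a : ℝ) : Measurable (szegoWeight (m := m) a) := by
  unfold szegoWeight
  fun_prop

lemma expDecay_szegoWeight (a : ℝ) :
    ExpDecay (2 * a) fun ξ : Vec m => szegoWeight a ξ • (1 : Cl m) := by
  have hm : AEStronglyMeasurable fun ξ : Vec m => szegoWeight a ξ • (1 : Cl m) :=
    (measurable_szegoWeight a).aestronglyMeasurable.smul aestronglyMeasurable_const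
  have hmb : ∀ b : ℝ, AEStronglyMeasurable fun ξ : Vec m =>
      Real.exp (b * ‖ξ‖) • szegoWeight a ξ • (1 : Cl m) :=
    fun b => (measurable_exp_mul_norm b).aestronglyMeasurable.smul hm
  refine ⟨hm, fun b hb => ?_⟩
  refine MemLp.of_le_mul (c := ‖(1 : Cl m)‖) (memLp_exp_neg_mul_norm (sub_pos.2 hb)) (hmb b)
    (ae_of_all _ fun ξ => le_of_eq ?_)
  rw [smul_smul, norm_smul, mul_comm, szegoWeight, ← Real.exp_add]
  congr 3
  ring

lemma bergmanWeight_smul (a : ℝ) (ξ : Vec m) (v : Cl m) :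
    bergmanWeight a ξ • v = (2 : ℝ) • ‖ξ‖ • szegoWeight a ξ • v := by
  rw [smul_smul, smul_smul]
  rfl

lemma expDecay_bergmanWeight (a : ℝ) :
    ExpDecay (2 * a) fun ξ : Vec m => bergmanWeight a ξ • (1 : Cl m) := by
  simp only [bergmanWeight_smul]
  exact (expDecay_szegoWeight a).norm_smul.real_smul 2

lemma add_paraConj_mem {ε a : ℝ} {w x : ParaVec m} (hw : w ∈ halfSpace m ε a)
    (hx : x ∈ halfSpace m ε a) : w + paraConj x ∈ halfSpace m ε (2 * a) := by
  have h1 : -a < ε * w.1 := hw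
  have h2 : -a < ε * x.1 := hx
  change -(2 * a) < ε * (w.1 + x.1)
  linarith

lemma le_add_of_mem {ε a : ℝ} {x : ParaVec m} (hx : x ∈ halfSpace m ε a) :
    a < 2 * a + ε * x.1 := by
  have h1 : -a < ε * x.1 := hx
  linarith

/-- On the slice `t` the pairing carries the weight `e^{-2(a + εt)|ξ|} ≤ 1`, which tends to `1` as
`t → -εa`; dominated convergence recovers the integral representing `f x`. -/
theorem isSzegoKernel_expKernel (hm : 1 ≤ m) {ε a : ℝ} (hε : ε = 1 ∨ ε = -1) :
    IsSzegoKernel (m := m) ε a (expKernel ε (szegoWeight a)) := by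
  have hee : ε * ε = 1 := by rcases hε with h | h <;> simp [h]
  intro x hx
  have hp := expDecay_szegoWeight (m := m) a
  refine ⟨?_, fun f hf => ?_⟩
  · simp only [expKernel_eq]
    exact memHardy_monInt hε (le_add_of_mem hx) (expDecay_kernelDensity hp x)
  obtain ⟨c, hc, hfc⟩ := hf.exists_monInt_eq hm hε
  have hint := integrable_monExp_mul hε hc hx
  have hlim : Tendsto (fun t : ℝ => ∫ ξ, (((2 * Real.pi) ^ m)⁻¹ *
      (Real.exp (-(ε * t) * (2 * ‖ξ‖)) * szegoWeight a ξ)) • (monExp ε x ξ * c ξ))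
      (𝓝[{t : ℝ | -a < ε * t}] (-(ε * a))) (𝓝 (∫ ξ, ((2 * Real.pi) ^ m)⁻¹ •
        (monExp ε x ξ * c ξ))) := by
    refine tendsto_integral_filter_of_dominated_convergence
      (fun ξ => ((2 * Real.pi) ^ m)⁻¹ * ‖monExp ε x ξ * c ξ‖) ?_ ?_ (hint.norm.const_mul _) ?_
    · refine Eventually.of_forall fun t => ?_
      have h1 : Measurable fun ξ : Vec m => ((2 * Real.pi) ^ m)⁻¹ *
          (Real.exp (-(ε * t) * (2 * ‖ξ‖)) * szegoWeight a ξ) := by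
        unfold szegoWeight
        fun_prop
      exact h1.aestronglyMeasurable.smul hint.1
    · filter_upwards [self_mem_nhdsWithin] with t ht
      refine ae_of_all _ fun ξ => ?_
      have ht' : -a < ε * t := ht
      have h1 : Real.exp (-(ε * t) * (2 * ‖ξ‖)) * szegoWeight a ξ ≤ 1 := by
        rw [szegoWeight, ← Real.exp_add, Real.exp_le_one_iff]
        nlinarith [norm_nonneg ξ]
      have h0 : 0 ≤ szegoWeight a ξ := (Real.exp_pos _).le
      rw [norm_smul, Real.norm_of_nonneg (by positivity)]
      gcongr
      exact mul_le_of_le_one_right (by positivity) h1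
    · refine ae_of_all _ fun ξ => tendsto_nhdsWithin_of_tendsto_nhds ?_
      have h1 : Continuous fun t : ℝ => (((2 * Real.pi) ^ m)⁻¹ *
          (Real.exp (-(ε * t) * (2 * ‖ξ‖)) * szegoWeight a ξ)) • (monExp ε x ξ * c ξ) := by
        fun_prop
      have h2 := h1.tendsto (-(ε * a))
      have h3 : Real.exp (-(ε * -(ε * a)) * (2 * ‖ξ‖)) * szegoWeight a ξ = 1 := by
        rw [szegoWeight, ← Real.exp_add, Real.exp_eq_one_iff]
        linear_combination 2 * a * ‖ξ‖ * hee
      rwa [h3, mul_one] at h2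
  rw [integral_smul, ← one_div, ← monInt, ← hfc hx] at hlim
  refine hlim.congr' ?_
  filter_upwards [self_mem_nhdsWithin] with t ht
  rw [one_div, integral_conj_expKernel_mul hm hε hp hc (le_add_of_mem hx).le hfc ht]

/-- Against the norm weight `1/(2|ξ|)`, the square of the factor `2|ξ|` leaves one power of `|ξ|`,
absorbed by raising the rate from `a` to some `b < 2a + εx₀`. -/
lemma memBergman_expKernel (hm : 1 ≤ m) {ε a : ℝ} (hε : ε = 1 ∨ ε = -1) {x : ParaVec m}
    (hx : x ∈ halfSpace m ε a) :
    MemBergman ε a fun w => expKernel ε (bergmanWeight a) w x := by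
  have hlt := le_add_of_mem hx
  have hd := expDecay_kernelDensity (ε := ε) (expDecay_bergmanWeight (m := m) a) x
  have hs := expDecay_kernelDensity (ε := ε) (expDecay_szegoWeight (m := m) a) x
  simp only [expKernel_eq]
  rw [memBergman_monInt_iff hm hε (hd.mono hlt.le)]
  obtain ⟨b, hb1, hb2⟩ := exists_between hlt
  have hL := (hs.chi_mul hε).2 b hb2
  have hL' := (memLp_two_iff hL.1).1 hL
  have heq : ∀ ξ : Vec m, chi ε ξ * kernelDensity ε (bergmanWeight a) x ξ =
      (2 * ‖ξ‖) • (chi ε ξ * kernelDensity ε (szegoWeight a) x ξ) := fun ξ => by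
    rw [kernelDensity, bergmanWeight_smul, kernelDensity, ← mul_real_smul, smul_smul (2 : ℝ),
      smul_comm]
  have hba : 0 < b - a := sub_pos.2 hb1
  calc _ ≤ ∫⁻ ξ, ENNReal.ofReal ((b - a)⁻¹) *
        ‖Real.exp (b * ‖ξ‖) • (chi ε ξ * kernelDensity ε (szegoWeight a) x ξ)‖ₑ ^ 2 := by
        refine lintegral_mono_ae ?_
        filter_upwards [ae_ne_zero_vec hm] with ξ hξ
        have hξ' : 0 < ‖ξ‖ := norm_pos_iff.2 hξ
        rw [heq, enorm_exp_smul_sq, ← ofReal_norm (chi ε ξ * _),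
          ← ENNReal.ofReal_pow (norm_nonneg _), ← ENNReal.ofReal_mul (Real.exp_pos _).le,
          ← ENNReal.ofReal_mul (by positivity), norm_smul, Real.norm_of_nonneg (by positivity)]
        refine ENNReal.ofReal_le_ofReal ?_
        set q := ‖chi ε ξ * kernelDensity ε (szegoWeight a) x ξ‖
        have h1 := norm_mul_exp_le (by linarith : 2 * a < 2 * b) ξ
        calc _ = 2 * (‖ξ‖ * Real.exp (2 * a * ‖ξ‖)) * q ^ 2 := by
              field_simp
          _ ≤ 2 * ((2 * b - 2 * a)⁻¹ * Real.exp (2 * b * ‖ξ‖)) * q ^ 2 := by gcongr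
          _ = _ := by
            rw [show 2 * b - 2 * a = 2 * (b - a) by ring]
            field_simp
    _ < ⊤ := by
        rw [lintegral_const_mul' _ _ ENNReal.ofReal_ne_top]
        exact ENNReal.mul_lt_top ENNReal.ofReal_lt_top hL'

/-- The slice weight `κ t ξ` is nonnegative and its integral over `t` is the constant `(2π)^{-m}`
for `ξ ≠ 0`. Integrability of `e^ε(x, ξ) c(ξ)` thus gives joint integrability, and swapping the
integrals returns `f x`. -/
theorem isBergmanKernel_expKernel (hm : 1 ≤ m) {ε a : ℝ} (hε : ε = 1 ∨ ε = -1) :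
    IsBergmanKernel (m := m) ε a (expKernel ε (bergmanWeight a)) := by
  intro x hx
  have hp := expDecay_bergmanWeight (m := m) a
  have hB := memBergman_expKernel hm hε hx
  refine ⟨hB, fun f hf => ?_⟩
  obtain ⟨c, hc, hfc⟩ := hf.exists_monInt_eq hm hε
  have hint := integrable_monExp_mul hε hc hx
  have hI := integrable_conj_mul hB.memLp hf.memLp
  rw [restrict_halfSpace] at hI ⊢
  rw [integral_prod _ hI]
  set κ : ℝ → Vec m → ℝ := fun t ξ =>
    ((2 * Real.pi) ^ m)⁻¹ * (Real.exp (-(ε * t) * (2 * ‖ξ‖)) * bergmanWeight a ξ) with hκ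
  have hκ0 : ∀ t ξ, 0 ≤ κ t ξ := fun t ξ => by
    simp only [hκ, bergmanWeight]
    positivity
  have h1 : ∫ t in {t : ℝ | -a < ε * t}, ∫ y : Vec m,
      conj (expKernel ε (bergmanWeight a) (t, y) x) * f (t, y) =
      ∫ t in {t : ℝ | -a < ε * t}, ∫ ξ, κ t ξ • (monExp ε x ξ * c ξ) :=
    setIntegral_congr_fun (isOpen_times ε a).measurableSet fun t ht =>
      integral_conj_expKernel_mul hm hε hp hc (le_add_of_mem hx).le hfc ht
  have hκi : ∀ ξ, ξ ≠ 0 → ∫ t in {t : ℝ | -a < ε * t}, κ t ξ = ((2 * Real.pi) ^ m)⁻¹ := by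
    intro ξ hξ
    have hk : 0 < 2 * ‖ξ‖ := by positivity
    simp only [hκ]
    rw [integral_const_mul, integral_mul_const, integral_exp_times hε a hk, bergmanWeight,
      div_mul_eq_mul_div, mul_comm (2 * ‖ξ‖), ← mul_assoc, ← Real.exp_add,
      show a * (2 * ‖ξ‖) + -(2 * a * ‖ξ‖) = 0 by ring, Real.exp_zero, one_mul, div_self hk.ne',
      mul_one]
  have hκint : ∀ ξ, ξ ≠ 0 → IntegrableOn (fun t => κ t ξ) {t : ℝ | -a < ε * t} := by
    intro ξ hξ
    have hk : 0 < 2 * ‖ξ‖ := by positivity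
    exact ((integrableOn_exp_times hε a hk).mul_const _).const_mul _
  have hκm : Measurable fun q : ℝ × Vec m => κ q.1 q.2 := by
    simp only [hκ, bergmanWeight]
    fun_prop
  have hsw : Integrable (fun q : ℝ × Vec m => κ q.1 q.2 • (monExp ε x q.2 * c q.2))
      ((volume.restrict {t : ℝ | -a < ε * t}).prod volume) := by
    have hsm : AEStronglyMeasurable (fun q : ℝ × Vec m => κ q.1 q.2 • (monExp ε x q.2 * c q.2))
        ((volume.restrict {t : ℝ | -a < ε * t}).prod volume) :=
      hκm.aestronglyMeasurable.smul hint.1.comp_snd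
    rw [integrable_prod_iff' hsm]
    refine ⟨?_, ?_⟩
    · filter_upwards [ae_ne_zero_vec hm] with ξ hξ
      exact (hκint ξ hξ).smul_const _
    · refine (hint.norm.const_mul ((2 * Real.pi) ^ m)⁻¹).congr ?_
      filter_upwards [ae_ne_zero_vec hm] with ξ hξ
      simp only [norm_smul, Real.norm_of_nonneg (hκ0 _ _)]
      rw [integral_mul_const, hκi ξ hξ]
  refine Eq.trans ?_ h1.symm
  rw [integral_integral_swap hsw, hfc hx, monInt, ← integral_smul]
  refine integral_congr_ae ?_
  filter_upwards [ae_ne_zero_vec hm] with ξ hξ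
  rw [integral_smul_const, hκi ξ hξ, one_div]

/-! ### Uniqueness of the kernels and the derivative formula -/

lemma neBot_times {ε : ℝ} (hε : ε = 1 ∨ ε = -1) (a : ℝ) :
    (𝓝[{t : ℝ | -a < ε * t}] (-(ε * a))).NeBot := by
  rcases hε with rfl | rfl
  · have h1 : {t : ℝ | -a < 1 * t} = Set.Ioi (-a) := by
      ext t
      simp
    rw [h1, one_mul]
    infer_instance
  · have h1 : {t : ℝ | -a < -1 * t} = Set.Iio a := by
      ext t
      simp
    rw [h1, neg_one_mul, neg_neg]
    infer_instance

lemma conj_integral {α : Type*} [MeasurableSpace α] (μ : Measure α) (F : α → Cl m) :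
    conj (∫ y, F y ∂μ) = ∫ y, conj (F y) ∂μ :=
  ((conjL m).toContinuousLinearEquiv.integral_comp_comm F).symm

/-- Each kernel reproduces the other: `S(w, x) = ⟨S(·, x), S'(·, w)⟩`, the conjugate of `⟨S'(·, w),
S(·, x)⟩ = S'(x, w)`. Taking a second kernel `S` with the same `S'` yields uniqueness. -/
lemma IsSzegoKernel.eq_conj {ε a : ℝ} (hε : ε = 1 ∨ ε = -1) {S S' : ParaVec m → ParaVec m → Cl m}
    (hS : IsSzegoKernel ε a S) (hS' : IsSzegoKernel ε a S') {w x : ParaVec m}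
    (hw : w ∈ halfSpace m ε a) (hx : x ∈ halfSpace m ε a) : S w x = conj (S' x w) := by
  have := neBot_times hε a
  have h1 := (hS' w hw).2 _ (hS x hx).1
  have h2 := (continuous_conj.tendsto _).comp ((hS x hx).2 _ (hS' w hw).1)
  refine tendsto_nhds_unique h1 (h2.congr fun t => ?_)
  simp only [Function.comp_apply, conj_integral, conj_mul, conj_conj]

lemma IsBergmanKernel.eq_conj {ε a : ℝ} {B B' : ParaVec m → ParaVec m → Cl m}
    (hB : IsBergmanKernel ε a B) (hB' : IsBergmanKernel ε a B') {w x : ParaVec m}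
    (hw : w ∈ halfSpace m ε a) (hx : x ∈ halfSpace m ε a) : B w x = conj (B' x w) := by
  rw [(hB' w hw).2 _ (hB x hx).1, (hB x hx).2 _ (hB' w hw).1, conj_integral]
  simp only [conj_mul, conj_conj]

/-- The `x₀`-derivative brings down `-ε|ξ|`, which is `-ε/2` times the extra factor `2|ξ|` of the
Bergman weight. -/
lemma hasDerivAt_expKernel_szegoWeight {ε a : ℝ} (hε : ε = 1 ∨ ε = -1) {w x : ParaVec m}
    (hw : w ∈ halfSpace m ε a) (hx : x ∈ halfSpace m ε a) :
    HasDerivAt (fun t : ℝ => expKernel ε (szegoWeight a) w (t, x.2))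
      ((-ε / 2) • expKernel ε (bergmanWeight a) w x) x.1 := by
  have hmem := add_paraConj_mem hw hx
  have hd := expDecay_szegoWeight (m := m) a
  have h1 : HasDerivAt (fun t : ℝ => w + paraConj ((t, x.2) : ParaVec m)) (1, 0) x.1 :=
    ((hasDerivAt_id x.1).prodMk (hasDerivAt_const x.1 (-x.2))).const_add w
  have h2 := (hasFDerivAt_monInt hε hd hmem).differentiableAt.hasFDerivAt
  have h3 := h2.comp_hasDerivAt x.1 h1
  convert! h3 using 1
  rw [fderiv_monInt_apply hε hd hmem, expKernel, monInt, smul_comm, ← integral_smul]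
  congr 2
  funext ξ
  have h4 : expForm ε ξ (1, 0) = -((ε * ‖ξ‖ : ℝ) : ℂ) := by
    rw [expForm_apply]
    simp
  rw [h4, ← Complex.ofReal_neg, ← real_smul_eq, bergmanWeight_smul, mul_real_smul, mul_real_smul,
    smul_smul, smul_smul]
  congr 1
  ring

end CliffordHalfSpace

theorem mainTheorem8 (m : ℕ) (hm : 1 ≤ m) (a : ℝ) (ha : 0 < a) (ε : ℝ) (hε : ε = 1 ∨ ε = -1) :
    -- the characterization of the Bergman space
    (∀ f : ParaVec m → Cl m, MemBergman ε a f ↔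
      ∃ g : Vec m → Cl m,
        MeasureTheory.MemLp g 2 MeasureTheory.volume ∧
        IsFourierTransformL2 (fun y => f (0, y)) g ∧
        ∫⁻ ξ : Vec m, ENNReal.ofReal
          (Real.exp (2 * a * ‖ξ‖) * (‖chi ε ξ * g ξ‖ ^ 2 / (2 * ‖ξ‖))) < ⊤ ∧
        ∀ x ∈ halfSpace m ε a,
          MeasureTheory.Integrable (fun ξ : Vec m => monExp ε x ξ * g ξ) ∧
          f x = (1 / (2 * Real.pi) ^ m : ℝ) • ∫ ξ : Vec m, monExp ε x ξ * g ξ) ∧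
    -- the Bergman and Szegő kernels exist, are unique on the half-space, and are related by
    -- `B = ∓ 2 ∂S/∂x₀`
    (∃ S : ParaVec m → ParaVec m → Cl m, IsSzegoKernel ε a S) ∧
    (∃ B : ParaVec m → ParaVec m → Cl m, IsBergmanKernel ε a B) ∧
    ∀ S B : ParaVec m → ParaVec m → Cl m, IsSzegoKernel ε a S → IsBergmanKernel ε a B →
      ∀ w ∈ halfSpace m ε a, ∀ x ∈ halfSpace m ε a,
        S w x = (1 / (2 * Real.pi) ^ m : ℝ) •
          ∫ ξ : Vec m, Real.exp (-(2 * a * ‖ξ‖)) • monExp ε (w + paraConj x) ξ ∧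
        B w x = (1 / (2 * Real.pi) ^ m : ℝ) •
          ∫ ξ : Vec m, (2 * ‖ξ‖ * Real.exp (-(2 * a * ‖ξ‖))) • monExp ε (w + paraConj x) ξ ∧
        DifferentiableAt ℝ (fun t : ℝ => S w (t, x.2)) x.1 ∧
        B w x = (-ε * 2) • deriv (fun t : ℝ => S w (t, x.2)) x.1 := by
  refine ⟨fun f => memBergman_iff hm ha hε f, ⟨_, isSzegoKernel_expKernel hm hε⟩,
    ⟨_, isBergmanKernel_expKernel hm hε⟩, fun S B hS hB w hw x hx => ?_⟩
  have hS0 := isSzegoKernel_expKernel (m := m) hm (a := a) hε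
  have hB0 := isBergmanKernel_expKernel (m := m) hm (a := a) hε
  have hSe : ∀ {x}, x ∈ halfSpace m ε a → S w x = expKernel ε (szegoWeight a) w x := fun hx =>
    (hS.eq_conj hε hS0 hw hx).trans (hS0.eq_conj hε hS0 hw hx).symm
  have hBe : B w x = expKernel ε (bergmanWeight a) w x :=
    (hB.eq_conj hB0 hw hx).trans (hB0.eq_conj hB0 hw hx).symm
  have hder : HasDerivAt (fun t : ℝ => S w (t, x.2))
      ((-ε / 2) • expKernel ε (bergmanWeight a) w x) x.1 := by
    -- An arbitrary Szegő kernel agrees with the explicit one only on the half-space, which is open;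
    -- that suffices for the derivative.
    refine (hasDerivAt_expKernel_szegoWeight hε hw hx).congr_of_eventuallyEq ?_
    filter_upwards [(isOpen_times ε a).mem_nhds (show -a < ε * x.1 from hx)] with t ht
    exact hSe ht
  have hee : ε * ε = 1 := by rcases hε with h | h <;> simp [h]
  refine ⟨?_, ?_, hder.differentiableAt, ?_⟩
  · rw [hSe hx]
    simp only [expKernel, monInt, mul_real_smul, mul_one, szegoWeight]
  · rw [hBe]
    simp only [expKernel, monInt, mul_real_smul, mul_one, bergmanWeight]
  · rw [hBe, hder.deriv, smul_smul, show -ε * 2 * (-ε / 2) = ε * ε by ring, hee, one_smul]
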